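/- Work in six-dimensional Minkowski space with metric $\eta=\mathrm{diag}(-1,1,1,1,1,1)$ and $\varepsilon^{012345}=1$. A 3-form is a fully antisymmetric real tensor $T_{ijk}$, with Hodge dual $(\star T)_{ijk}=\frac16\varepsilon_{ijklmn}T^{lmn}$ (so $\star\star=1$). For a 3-form $Y$ put $M_i{}^j=Y_{ikl}Y^{jkl}$ and $I_4(Y)=M_i{}^jM_j{}^i$. For a polynomial $\mathcal F$ in one variable let $X=\partial\mathcal F(I_4(Y))/\partial Y$ be the 3-form with $\delta\,\mathcal F(I_4(Y))=X_{ijk}\,\delta Y^{ijk}$ for all 3-form variations $\delta Y$. Let $\mathfrak g$ be a function from selfdual 3-forms ($\star Y=Y$) to 3-forms that is polynomial in the components of $Y$ and covariant, i.e. $\mathfrak g(\Lambda Y)=\Lambda\,\mathfrak g(Y)$ for every proper orthochronous Lorentz transformation $\Lambda$. Then there is a real polynomial $\mathcal F$ in one variable such that: 1. For every 3-form $H$, the equation $$H-\star H=\mathfrak g(H+\star H)-\star\mathfrak g(H+\star H)\qquad (*)$$ holds if and only if $$\star H-H+\star X-X=0,\qquad X=\left.\frac{\partial\mathcal F(I_4(Y))}{\partial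 Y}\right|_{Y=H+\star H}.$$ 2. Consequently the equation is covered by the Lagrangian $$\mathcal L=H\wedge\star H+2a\,F\wedge Q+\tfrac13\mathcal F(I_4(H+\star H)),\qquad F=dA,\quad Q=dR,\quad H=F+aQ$$ (6-forms being identified with their coefficient of $dx^0\wedge\cdots\wedge dx^5$). That is, let $A,R$ be smooth 2-forms and $a$ a smooth function on an open set $U\subseteq\mathbb R^{1,5}$ with $\partial_ia\,\partial^ia\neq0$ everywhere on $U$. Then $(A,R,a)$ satisfies the Euler–Lagrange equations of $\mathcal L$ on $U$ if and only if on $U$ one has $da\wedge dR=0$ and $H=dA+a\,dR$ satisfies $(*)$. In particular, for $R=0$ the Euler–Lagrange equations hold if and only if $F=dA$ satisfies $(*)$. -/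

import Mathlib

open scoped ContDiff

noncomputable section

namespace Chiral6d

/-! ## Tensors on six-dimensional Minkowski space

The metric is `diag(-1,1,1,1,1,1)`; tensors are given by their components with lower indices. -/

/-- Diagonal entries of the Minkowski metric. -/
def eta (i : Fin 6) : ℝ := if i = 0 then -1 else 1

/-- The Minkowski metric as a matrix. -/
def etaMatrix : Matrix (Fin 6) (Fin 6) ℝ := Matrix.diagonal eta

/-- Rank 3 tensors `T_{ijk}`. -/
abbrev Tensor3 : Type := Fin 6 → Fin 6 → Fin 6 → ℝ

/-- 3-forms: the fully antisymmetric rank 3 tensors. -/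
def IsThreeForm (T : Tensor3) : Prop :=
  (∀ i j k, T j i k = -T i j k) ∧ (∀ i j k, T i k j = -T i j k)

/-- `T^{ijk}`: all three indices raised with the metric. -/
def raise (T : Tensor3) : Tensor3 := fun i j k => eta i * eta j * eta k * T i j k

/-- The Levi-Civita symbol `ε^{ijklmn}` with `ε^{012345} = 1`. -/
def epsUpper (i j k l m n : Fin 6) : ℝ :=
  Matrix.det (Matrix.of fun r c : Fin 6 => if (![i, j, k, l, m, n] : Fin 6 → Fin 6) r = c
    then (1 : ℝ) else 0)

/-- `ε_{ijklmn}`: lowering all six indices multiplies by `det η = -1`. -/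
def epsLower (i j k l m n : Fin 6) : ℝ := -epsUpper i j k l m n

/-- The Hodge star on 3-forms, `(⋆T)_{ijk} = (1/6) ε_{ijklmn} T^{lmn}`. -/
def hodge (T : Tensor3) : Tensor3 := fun i j k =>
  (1 / 6) * ∑ l, ∑ m, ∑ n, epsLower i j k l m n * raise T l m n

/-- Selfdual 3-forms, `⋆Y = Y`. -/
def IsSelfdual (Y : Tensor3) : Prop := IsThreeForm Y ∧ hodge Y = Y

/-- `M_i^j = Y_{ikl} Y^{jkl}`. -/
def tensorM (Y : Tensor3) (i j : Fin 6) : ℝ := ∑ k, ∑ l, Y i k l * raise Y j k l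

/-- `I₄ = M_i^j M_j^i = Tr M²`. -/
def I4 (Y : Tensor3) : ℝ := ∑ i, ∑ j, tensorM Y i j * tensorM Y j i

/-! ## Covariant polynomial 3-form-valued functions of a selfdual 3-form -/

/-- The proper orthochronous Lorentz transformations. -/
def IsLorentz (L : Matrix (Fin 6) (Fin 6) ℝ) : Prop :=
  L.transpose * etaMatrix * L = etaMatrix ∧ L.det = 1 ∧ 0 < L 0 0

/-- The action of a matrix on rank 3 tensors. -/
def act (L : Matrix (Fin 6) (Fin 6) ℝ) (T : Tensor3) : Tensor3 := fun i j k =>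
  ∑ p, ∑ q, ∑ r, L i p * L j q * L k r * T p q r

/-- `g` is a Lorentz-covariant 3-form depending polynomially on the components of a selfdual
3-form `Y`. The values of `g` off the selfdual 3-forms are irrelevant. -/
structure IsCovariantPolynomial (g : Tensor3 → Tensor3) : Prop where
  isThreeForm : ∀ Y, IsSelfdual Y → IsThreeForm (g Y)
  polynomial : ∃ P : Fin 6 → Fin 6 → Fin 6 → MvPolynomial (Fin 6 × Fin 6 × Fin 6) ℝ,
    ∀ Y, IsSelfdual Y → ∀ i j k,
      g Y i j k = MvPolynomial.eval (fun s => Y s.1 s.2.1 s.2.2) (P i j k)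
  covariant : ∀ L, IsLorentz L → ∀ Y, IsSelfdual Y → g (act L Y) = act L (g Y)

/-- The nonlinear selfduality equation `H - ⋆H = g(H + ⋆H) - ⋆g(H + ⋆H)`. -/
def SelfdualityEq (g : Tensor3 → Tensor3) (H : Tensor3) : Prop :=
  H - hodge H = g (H + hodge H) - hodge (g (H + hodge H))

/-! ## Derivative of a scalar with respect to a 3-form -/

/-- The 3-form unit tensor: `δ^{[i}_a δ^j_b δ^{k]}_c`, antisymmetrised with weight one. -/
def unitForm (i j k : Fin 6) : Tensor3 := fun a b c =>
  (1 / 6) * Matrix.det (Matrix.of fun r s : Fin 3 =>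
    if (![i, j, k] : Fin 3 → Fin 6) r = (![a, b, c] : Fin 3 → Fin 6) s then (1 : ℝ) else 0)

/-- The 3-form `X_{ijk} = ∂f/∂Y^{ijk}`, characterised by `δf = X_{ijk} δY^{ijk}` for every
variation `δY` of `Y` that is a 3-form (all index triples summed). -/
def formDeriv (f : Tensor3 → ℝ) (Y : Tensor3) : Tensor3 := fun i j k =>
  eta i * eta j * eta k * fderiv ℝ f Y (unitForm i j k)

/-- `X = ∂𝓕(I₄)/∂Y` at `Y`. -/
def tensorX (F : Polynomial ℝ) (Y : Tensor3) : Tensor3 := formDeriv (fun T => F.eval (I4 T)) Y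

/-! ## The chiral Lagrangian in six dimensions -/

/-- Points of Minkowski space, in inertial coordinates. -/
abbrev Spacetime : Type := Fin 6 → ℝ

/-- 2-forms: antisymmetric rank 2 tensors. -/
def TwoForm : Submodule ℝ (Fin 6 → Fin 6 → ℝ) where
  carrier := {B | ∀ i j, B j i = -B i j}
  add_mem' := by
    intro B C hB hC i j
    simp only [Pi.add_apply, hB i j, hC i j]
    ring
  zero_mem' := by
    intro i j
    simp
  smul_mem' := by
    intro c B hB i j
    simp only [Pi.smul_apply, smul_eq_mul, hB i j]
    ring

/-- Values of the fields `(A, R, a)` at a point: two 2-forms and a scalar. -/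
abbrev FieldSpace : Type := TwoForm × TwoForm × ℝ

/-- The first partial derivatives of a field. -/
def jet {V : Type*} [NormedAddCommGroup V] [NormedSpace ℝ V] (u : Spacetime → V)
    (x : Spacetime) : Fin 6 → V := fun i => fderiv ℝ u x (Pi.single i 1)

/-- The exterior derivative `(dB)_{ijk} = ∂_i B_{jk} + ∂_j B_{ki} + ∂_k B_{ij}`, as a function of
the partial derivatives `D i = ∂_i B` of the 2-form `B`. -/
def extDer (D : Fin 6 → TwoForm) : Tensor3 := fun i j k =>
  (D i : Fin 6 → Fin 6 → ℝ) j k + (D j : Fin 6 → Fin 6 → ℝ) k i + (D k : Fin 6 → Fin 6 → ℝ) i j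

/-- The coefficient of `dx⁰ ∧ ⋯ ∧ dx⁵` in `G ∧ K`, for 3-forms `G` and `K`. -/
def wedge (G K : Tensor3) : ℝ :=
  (1 / 36) * ∑ i, ∑ j, ∑ k, ∑ l, ∑ m, ∑ n, epsUpper i j k l m n * G i j k * K l m n

/-- `v ∧ G` for a 1-form `v` and a 3-form `G`. -/
def wedgeOne (v : Fin 6 → ℝ) (G : Tensor3) : Fin 6 → Fin 6 → Fin 6 → Fin 6 → ℝ :=
  fun i j k l => v i * G j k l - v j * G i k l + v k * G i j l - v l * G i j k

/-- `v² = v_i v^i`. -/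
def normSq (v : Fin 6 → ℝ) : ℝ := ∑ i, eta i * v i * v i

/-- The field strength `F = dA`, as a function of the first derivatives of the fields. -/
def strengthF (p : Fin 6 → FieldSpace) : Tensor3 := extDer fun i => (p i).1

/-- The field strength `Q = dR`. -/
def strengthQ (p : Fin 6 → FieldSpace) : Tensor3 := extDer fun i => (p i).2.1

/-- `H = F + a Q`. -/
def strengthH (v : FieldSpace) (p : Fin 6 → FieldSpace) : Tensor3 :=
  strengthF p + v.2.2 • strengthQ p

/-- The Lagrangian density `H² + 2 a F ∧ Q + 𝓕(I₄(Y))` with `H² = H ∧ ⋆H` and `Y = H + ⋆H`, as a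
function of the values `v` and the first derivatives `p` of the fields `(A, R, a)`. -/
def lagrangian (F : Polynomial ℝ) (v : FieldSpace) (p : Fin 6 → FieldSpace) : ℝ :=
  wedge (strengthH v p) (hodge (strengthH v p))
    + 2 * v.2.2 * wedge (strengthF p) (strengthQ p)
    + F.eval (I4 (strengthH v p + hodge (strengthH v p)))

/-- The Euler-Lagrange equations `∂L/∂u = ∂_i (∂L/∂(∂_i u))` of a first-order Lagrangian `L` hold
for the field `u` at the point `x`; `w` runs over the components of the field. -/
def EulerLagrange {V : Type*} [NormedAddCommGroup V] [NormedSpace ℝ V]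
    (L : V → (Fin 6 → V) → ℝ) (u : Spacetime → V) (x : Spacetime) : Prop :=
  ∀ w : V, fderiv ℝ (fun v => L v (jet u x)) (u x) w =
    ∑ i, jet (fun y => fderiv ℝ (L (u y)) (jet u y) (Pi.single i w)) x i

end Chiral6d

end

open Chiral6d

/-!
Write `pair S T = S_{ijk} T^{ijk}`. The Hodge star squares to one on 3-forms and is antisymmetric
for the pairing, so only the antiselfdual part of `g(Y)` enters the selfduality equation, and this
part is determined by the pairings of `g(Y)` with selfdual forms.

*Reduction to normal forms.* A selfdual form is determined by its electric components `Y_{0jk}`, a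
skew-symmetric matrix of size five, and a spatial rotation brings this matrix to block form
(`exists_rotation_skewBlock`). Hence every selfdual form is Lorentz equivalent to some
`N(u,v) = u (dx⁰ - dx⁵) ∧ (dx¹² + dx³⁴) + v (dx⁰ + dx⁵) ∧ (dx¹² - dx³⁴)`
(`exists_act_normalForm`). The rotations by `π` in the planes `12` and `34` fix all `N(u,v)`, and
averaging over them projects the selfdual forms onto the normal forms; so a covariant expression
that is linear in a second selfdual form vanishes as soon as it vanishes on pairs of normal forms
(`eq_zero_of_normalForm`).

*Integrability.* On normal forms, covariance under the boosts in the `05` plane, the exchange of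
the planes `12` and `34` (which flips `v`) and the exchange of the two null directions forces
`⟨g(N), δN⟩ = f(u²v²) δ(u²v²)/2` with a polynomial `f` (`exists_pair_normalForm`). Since
`I₄(N) = 384 u²v²`, this is minus the variation of `𝓕(I₄)`, where `𝓕` is a primitive of
`s ↦ -f(s/384)/768`. Therefore `g(Y) + ∂𝓕(I₄)/∂Y` has no antiselfdual part (`exists_tensorX`).

*Equations of motion.* Put `E = H + X - ⋆X`; the selfduality equation reads `E = ⋆H`, and
`E - ⋆H` is antiselfdual. By the Bianchi identities the Euler–Lagrange equations of `a`, `A` and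
`R` are the vanishing of `⟨E - ⋆F, Q⟩`, of `div E + i_{da} ⋆Q` and of
`i_{da}(E - ⋆F) + a div E` (`eulerLagrange_iff`). Subtracting `a` times the second from the third
leaves `i_{da}(E - ⋆H) = 0`. An antiselfdual form annihilated by a non-null vector vanishes
(`eq_zero_of_interior_eq_zero`), so `E = ⋆H`. Then `div E = i_{da} ⋆Q`, and the equation of `A`
becomes `2 i_{da} ⋆Q = 0`, that is `da ∧ Q = 0` (`forall_eulerLagrange_iff`).
-/

noncomputable section

namespace Chiral6d

/-! ### The Levi-Civita symbol -/

/-- The Levi-Civita symbol `ε^{f 0 ... f 5}` as a function of the tuple of its indices. -/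
def levi (f : Fin 6 → Fin 6) : ℝ :=
  Matrix.det (Matrix.of fun r c : Fin 6 => if f r = c then (1 : ℝ) else 0)

lemma epsUpper_eq_levi (i j k l m n : Fin 6) :
    epsUpper i j k l m n = levi ![i, j, k, l, m, n] := rfl

lemma levi_comp (f : Fin 6 → Fin 6) (σ : Equiv.Perm (Fin 6)) :
    levi (f ∘ σ) = (Equiv.Perm.sign σ : ℤ) * levi f := by
  unfold levi
  rw [← Matrix.det_permute]
  rfl

lemma levi_comp_swap (f : Fin 6 → Fin 6) {a b : Fin 6} (h : a ≠ b) :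
    levi (f ∘ Equiv.swap a b) = -levi f := by
  rw [levi_comp, Equiv.Perm.sign_swap h]
  simp

lemma levi_eq_zero {f : Fin 6 → Fin 6} {a b : Fin 6} (hab : a ≠ b) (h : f a = f b) :
    levi f = 0 := by
  unfold levi
  apply Matrix.det_zero_of_row_eq hab
  funext c
  simp [h]

lemma injective_of_levi_ne_zero {f : Fin 6 → Fin 6} (h : levi f ≠ 0) : Function.Injective f := by
  intro a b hab
  by_contra hne
  exact h (levi_eq_zero hne hab)

lemma levi_id : levi id = 1 := by
  unfold levi
  convert Matrix.det_one (R := ℝ) (n := Fin 6) using 2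
  ext r c
  simp [Matrix.one_apply]

lemma levi_mul_self {f : Fin 6 → Fin 6} (h : Function.Injective f) : levi f * levi f = 1 := by
  have hf : levi f = (Equiv.Perm.sign (Equiv.ofBijective f (Finite.injective_iff_bijective.1 h)) : ℤ)
      * levi id := by
    rw [← levi_comp]
    rfl
  rw [hf, levi_id, mul_one]
  rcases Int.units_eq_one_or (Equiv.Perm.sign (Equiv.ofBijective f
    (Finite.injective_iff_bijective.1 h))) with h | h <;> simp [h]

lemma levi_swap_first (i j k l m n : Fin 6) :
    levi ![j, i, k, l, m, n] = -levi ![i, j, k, l, m, n] := by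
  rw [← levi_comp_swap _ (show (0 : Fin 6) ≠ 1 by decide)]
  congr 1
  funext a
  fin_cases a <;> rfl

lemma levi_swap_second (i j k l m n : Fin 6) :
    levi ![i, k, j, l, m, n] = -levi ![i, j, k, l, m, n] := by
  rw [← levi_comp_swap _ (show (1 : Fin 6) ≠ 2 by decide)]
  congr 1
  funext a
  fin_cases a <;> rfl

lemma levi_swap_third (i j k l m n : Fin 6) :
    levi ![i, j, l, k, m, n] = -levi ![i, j, k, l, m, n] := by
  rw [← levi_comp_swap _ (show (2 : Fin 6) ≠ 3 by decide)]
  congr 1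
  funext a
  fin_cases a <;> rfl

lemma levi_swap_fourth (i j k l m n : Fin 6) :
    levi ![i, j, k, m, l, n] = -levi ![i, j, k, l, m, n] := by
  rw [← levi_comp_swap _ (show (3 : Fin 6) ≠ 4 by decide)]
  congr 1
  funext a
  fin_cases a <;> rfl

lemma levi_swap_fifth (i j k l m n : Fin 6) :
    levi ![i, j, k, l, n, m] = -levi ![i, j, k, l, m, n] := by
  rw [← levi_comp_swap _ (show (4 : Fin 6) ≠ 5 by decide)]
  congr 1
  funext a
  fin_cases a <;> rfl

/-- `ε` is an invariant tensor up to the determinant. -/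
lemma sum_levi_mul_prod (L : Matrix (Fin 6) (Fin 6) ℝ) (f : Fin 6 → Fin 6) :
    ∑ p : Fin 6 → Fin 6, levi p * ∏ a, L (f a) (p a) = L.det * levi f := by
  -- Both sides are the determinant of the rows `f 0, ..., f 5` of `L`; the left one is its
  -- multilinear expansion.
  have h1 : L.det * levi f = (L.submatrix f id).det := by
    have : L.submatrix f id = (Matrix.of fun r c : Fin 6 => if f r = c then (1 : ℝ) else 0) * L := by
      ext r c
      simp [Matrix.mul_apply]
    rw [this, Matrix.det_mul, mul_comm]
    rfl
  have h2 : (L.submatrix f id : Fin 6 → Fin 6 → ℝ)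
      = fun a => ∑ c, L (f a) c • (Pi.single c (1 : ℝ) : Fin 6 → ℝ) := by
    funext a
    funext c
    simp [Finset.sum_apply, Pi.single_apply]
  rw [h1]
  change _ = (Matrix.detRowAlternating (n := Fin 6) (R := ℝ)) (L.submatrix f id : Fin 6 → Fin 6 → ℝ)
  rw [h2]
  change _ = (Matrix.detRowAlternating (n := Fin 6) (R := ℝ)).toMultilinearMap _
  rw [MultilinearMap.map_sum]
  refine Finset.sum_congr rfl fun p _ => ?_
  rw [MultilinearMap.map_smul_univ, smul_eq_mul, mul_comm]
  congr 1
  change levi p = Matrix.det _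
  unfold levi
  congr 1
  ext r c
  simp [Pi.single_apply, eq_comm]

lemma sum_levi_comp (σ : Equiv.Perm (Fin 6)) (G : (Fin 6 → Fin 6) → ℝ) :
    ∑ f, levi f * G (f ∘ σ) = (Equiv.Perm.sign σ : ℤ) * ∑ f, levi f * G f := by
  rw [← Equiv.sum_comp (Equiv.arrowCongr σ⁻¹ (Equiv.refl (Fin 6))) (fun f => levi f * G f),
    Finset.mul_sum]
  refine Finset.sum_congr rfl fun f _ => ?_
  have : (Equiv.arrowCongr σ⁻¹ (Equiv.refl (Fin 6))) f = f ∘ σ := by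
    funext a
    simp [Equiv.arrowCongr, Equiv.Perm.inv_def]
  rw [this, levi_comp]
  rcases Int.units_eq_one_or (Equiv.Perm.sign σ) with h | h <;> simp [h]

lemma sum_fun_succ {α M : Type*} [Fintype α] [AddCommMonoid M] {n : ℕ}
    (G : (Fin (n + 1) → α) → M) :
    ∑ f, G f = ∑ a, ∑ f : Fin n → α, G (Matrix.vecCons a f) := by
  rw [← Equiv.sum_comp (Fin.consEquiv fun _ : Fin (n + 1) => α), Fintype.sum_prod_type]
  rfl

/-- Sums over tuples of indices as iterated sums. -/
lemma sum_fun_six (G : (Fin 6 → Fin 6) → ℝ) :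
    ∑ f, G f = ∑ i, ∑ j, ∑ k, ∑ l, ∑ m, ∑ n, G ![i, j, k, l, m, n] := by
  simp only [sum_fun_succ, Finset.univ_unique, Finset.sum_singleton]
  rfl

lemma eta_mul_self (i : Fin 6) : eta i * eta i = 1 := by
  unfold eta
  split_ifs <;> norm_num

lemma prod_eta : ∏ i, eta i = -1 := by
  simp [eta]

/-- `det η = -1`. -/
lemma prod_eta_comp {f : Fin 6 → Fin 6} (h : Function.Injective f) :
    eta (f 0) * eta (f 1) * eta (f 2) * (eta (f 3) * eta (f 4) * eta (f 5)) = -1 := by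
  have := Equiv.prod_comp (Equiv.ofBijective f (Finite.injective_iff_bijective.1 h)) eta
  rw [prod_eta, Fin.prod_univ_six] at this
  simp only [Equiv.ofBijective_apply] at this
  linarith

lemma levi_mul_eta (f : Fin 6 → Fin 6) :
    levi f * (eta (f 0) * eta (f 1) * eta (f 2) * (eta (f 3) * eta (f 4) * eta (f 5))) = -levi f := by
  by_cases h : levi f = 0
  · simp [h]
  · rw [prod_eta_comp (injective_of_levi_ne_zero h)]
    ring

/-! ### The Hodge star and the pairing of 3-forms -/

lemma hodge_add (S T : Tensor3) : hodge (S + T) = hodge S + hodge T := by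
  funext i j k
  simp only [hodge, raise, Pi.add_apply, mul_add, Finset.sum_add_distrib]

lemma hodge_smul (c : ℝ) (T : Tensor3) : hodge (c • T) = c • hodge T := by
  funext i j k
  simp only [hodge, raise, Pi.smul_apply, smul_eq_mul, Finset.mul_sum]
  refine Finset.sum_congr rfl fun l _ => Finset.sum_congr rfl fun m _ =>
    Finset.sum_congr rfl fun n _ => ?_
  ring

/-- The Hodge star as a linear map. -/
def hodgeLin : Tensor3 →ₗ[ℝ] Tensor3 where
  toFun := hodge
  map_add' := hodge_add
  map_smul' := hodge_smul

lemma hodge_sub (S T : Tensor3) : hodge (S - T) = hodge S - hodge T := map_sub hodgeLin S T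

lemma hodge_zero : hodge 0 = 0 := map_zero hodgeLin

/-- The 3-forms as a subspace. -/
def threeForms : Submodule ℝ Tensor3 where
  carrier := {T | IsThreeForm T}
  add_mem' := by
    rintro S T ⟨h1, h2⟩ ⟨h3, h4⟩
    refine ⟨fun i j k => ?_, fun i j k => ?_⟩
    · simp only [Pi.add_apply, h1 i j k, h3 i j k]; ring
    · simp only [Pi.add_apply, h2 i j k, h4 i j k]; ring
  zero_mem' := ⟨by simp, by simp⟩
  smul_mem' := by
    rintro c T ⟨h1, h2⟩
    refine ⟨fun i j k => ?_, fun i j k => ?_⟩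
    · simp only [Pi.smul_apply, smul_eq_mul, h1 i j k]; ring
    · simp only [Pi.smul_apply, smul_eq_mul, h2 i j k]; ring

lemma IsThreeForm.add {S T : Tensor3} (hS : IsThreeForm S) (hT : IsThreeForm T) :
    IsThreeForm (S + T) := threeForms.add_mem hS hT

lemma IsThreeForm.sub {S T : Tensor3} (hS : IsThreeForm S) (hT : IsThreeForm T) :
    IsThreeForm (S - T) := threeForms.sub_mem hS hT

lemma IsThreeForm.smul {T : Tensor3} (c : ℝ) (hT : IsThreeForm T) :
    IsThreeForm (c • T) := threeForms.smul_mem c hT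

lemma IsThreeForm.eq_zero_left {T : Tensor3} (h : IsThreeForm T) (i k : Fin 6) : T i i k = 0 := by
  linarith [h.1 i i k]

lemma IsThreeForm.eq_zero_right {T : Tensor3} (h : IsThreeForm T) (i k : Fin 6) :
    T i k k = 0 := by
  linarith [h.2 i k k]

lemma IsThreeForm.eq_zero_outer {T : Tensor3} (h : IsThreeForm T) (i k : Fin 6) :
    T i k i = 0 := by
  linarith [h.1 i k i, h.eq_zero_right k i]

lemma IsThreeForm.cycle {T : Tensor3} (h : IsThreeForm T) (i j k : Fin 6) :
    T j k i = T i j k := by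
  rw [h.2 j i k, h.1 i j k, neg_neg]

lemma isThreeForm_hodge (T : Tensor3) : IsThreeForm (hodge T) := by
  have h1 : ∀ i j k l m n, epsLower j i k l m n = -epsLower i j k l m n := by
    intro i j k l m n
    simp only [epsLower, epsUpper_eq_levi, levi_swap_first i j]
  have h2 : ∀ i j k l m n, epsLower i k j l m n = -epsLower i j k l m n := by
    intro i j k l m n
    simp only [epsLower, epsUpper_eq_levi, levi_swap_second i j]
  constructor <;> intro i j k
  · simp only [hodge, h1 i j k, neg_mul, Finset.sum_neg_distrib, mul_neg]
  · simp only [hodge, h2 i j k, neg_mul, Finset.sum_neg_distrib, mul_neg]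

/-- The pairing `S_{ijk} T^{ijk}`. -/
def pair (S T : Tensor3) : ℝ := ∑ i, ∑ j, ∑ k, raise S i j k * T i j k

lemma pair_comm (S T : Tensor3) : pair S T = pair T S := by
  unfold pair raise
  refine Finset.sum_congr rfl fun l _ => Finset.sum_congr rfl fun m _ =>
    Finset.sum_congr rfl fun n _ => ?_
  ring

lemma pair_add_right (S T T' : Tensor3) : pair S (T + T') = pair S T + pair S T' := by
  simp only [pair, Pi.add_apply, mul_add, Finset.sum_add_distrib]

lemma pair_smul_right (c : ℝ) (S T : Tensor3) : pair S (c • T) = c * pair S T := by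
  simp only [pair, Pi.smul_apply, smul_eq_mul, Finset.mul_sum]
  refine Finset.sum_congr rfl fun l _ => Finset.sum_congr rfl fun m _ =>
    Finset.sum_congr rfl fun n _ => ?_
  ring

/-- The pairing as a bilinear form. -/
def pairLin : Tensor3 →ₗ[ℝ] Tensor3 →ₗ[ℝ] ℝ :=
  LinearMap.mk₂ ℝ pair
    (fun S S' T => by rw [pair_comm, pair_add_right, pair_comm T S, pair_comm T S'])
    (fun c S T => by rw [pair_comm, pair_smul_right, pair_comm T S, smul_eq_mul])
    pair_add_right pair_smul_right

lemma pair_add_left (S S' T : Tensor3) : pair (S + S') T = pair S T + pair S' T :=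
  pairLin.map_add₂ S S' T

lemma pair_smul_left (c : ℝ) (S T : Tensor3) : pair (c • S) T = c * pair S T :=
  pairLin.map_smul₂ c S T

lemma pair_sub_left (S S' T : Tensor3) : pair (S - S') T = pair S T - pair S' T :=
  pairLin.map_sub₂ S S' T

lemma pair_sub_right (S T T' : Tensor3) : pair S (T - T') = pair S T - pair S T' :=
  map_sub (pairLin S) T T'

lemma wedge_eq_sum (S T : Tensor3) :
    wedge S T = (1 / 36) * ∑ f, levi f * (S (f 0) (f 1) (f 2) * T (f 3) (f 4) (f 5)) := by
  rw [sum_fun_six]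
  simp only [wedge, epsUpper_eq_levi]
  congr 1
  simp only [mul_assoc]
  rfl

lemma pair_hodge_eq_wedge (S T : Tensor3) : pair S (hodge T) = 6 * wedge S T := by
  have h : pair S (hodge T) = ∑ f, (1 / 6) * (levi f *
      (S (f 0) (f 1) (f 2) * T (f 3) (f 4) (f 5))) := by
    rw [sum_fun_six]
    simp only [pair, hodge, raise, Finset.mul_sum]
    refine Finset.sum_congr rfl fun i _ => Finset.sum_congr rfl fun j _ =>
      Finset.sum_congr rfl fun k _ => Finset.sum_congr rfl fun l _ =>
      Finset.sum_congr rfl fun m _ => Finset.sum_congr rfl fun n _ => ?_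
    have := levi_mul_eta ![i, j, k, l, m, n]
    simp only [epsLower, epsUpper_eq_levi]
    change levi ![i, j, k, l, m, n] * (eta i * eta j * eta k * (eta l * eta m * eta n)) = _ at this
    change _ = 1 / 6 * (levi ![i, j, k, l, m, n] * (S i j k * T l m n))
    linear_combination (-(1 / 6) * (S i j k * T l m n)) * this
  rw [h, wedge_eq_sum, ← Finset.mul_sum]
  ring

lemma wedge_antisymm (S T : Tensor3) : wedge S T = -wedge T S := by
  have h := sum_levi_comp (Equiv.swap 0 3 * Equiv.swap 1 4 * Equiv.swap 2 5)
    (fun f => S (f 0) (f 1) (f 2) * T (f 3) (f 4) (f 5))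
  have hs : Equiv.Perm.sign (Equiv.swap 0 3 * Equiv.swap 1 4 * Equiv.swap 2 5 :
      Equiv.Perm (Fin 6)) = -1 := by decide
  rw [hs] at h
  rw [wedge_eq_sum, wedge_eq_sum]
  have h2 : ∑ f, levi f * (T (f 0) (f 1) (f 2) * S (f 3) (f 4) (f 5)) =
      ∑ f : Fin 6 → Fin 6, levi f * (S (f 3) (f 4) (f 5) * T (f 0) (f 1) (f 2)) := by
    simp only [mul_comm (T _ _ _)]
  rw [h2]
  have h3 : ∑ f : Fin 6 → Fin 6, levi f * (S (f 3) (f 4) (f 5) * T (f 0) (f 1) (f 2)) =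
    ((-1 : ℤˣ) : ℤ) * ∑ f, levi f * (S (f 0) (f 1) (f 2) * T (f 3) (f 4) (f 5)) := h
  rw [h3]
  push_cast
  ring

/-- The Hodge star is antisymmetric for the pairing, as for 3-forms in Lorentzian signature. -/
lemma pair_hodge (S T : Tensor3) : pair (hodge S) T = -pair S (hodge T) := by
  rw [pair_comm, pair_hodge_eq_wedge, pair_hodge_eq_wedge, wedge_antisymm]
  ring

lemma pair_hodge_self (T : Tensor3) : pair (hodge T) T = 0 := by
  have := pair_hodge T T
  rw [pair_comm T] at this
  linarith

/-! ### Components of the Hodge dual -/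

lemma sum_eq_three {l m n : Fin 6} (hlm : l ≠ m) (hln : l ≠ n) (hmn : m ≠ n) (s : Fin 6 → ℝ)
    (h : ∀ x, x ≠ l → x ≠ m → x ≠ n → s x = 0) : ∑ x, s x = s l + s m + s n := by
  rw [← Finset.sum_subset (Finset.subset_univ {l, m, n}),
    Finset.sum_insert (by simp [hlm, hln]), Finset.sum_pair hmn, add_assoc]
  intro x _ hx
  simp only [Finset.mem_insert, Finset.mem_singleton, not_or] at hx
  exact h x hx.1 hx.2.1 hx.2.2

/-- The components of the Hodge dual of a 3-form: a single component of the form survives for a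
tuple `f` of distinct indices. -/
lemma hodge_apply {T : Tensor3} (hT : IsThreeForm T) {f : Fin 6 → Fin 6}
    (hf : Function.Injective f) :
    hodge T (f 0) (f 1) (f 2) =
      -levi f * (eta (f 3) * eta (f 4) * eta (f 5) * T (f 3) (f 4) (f 5)) := by
  obtain ⟨i, j, k, l, m, n, rfl⟩ : ∃ i j k l m n, f = ![i, j, k, l, m, n] :=
    ⟨f 0, f 1, f 2, f 3, f 4, f 5, by funext a; fin_cases a <;> rfl⟩
  change hodge T i j k = -levi ![i, j, k, l, m, n] * (eta l * eta m * eta n * T l m n)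
  have hsurj := (Finite.injective_iff_surjective.1 hf)
  have hlm : l ≠ m := fun h => absurd (hf (a₁ := 3) (a₂ := 4) h) (by decide)
  have hln : l ≠ n := fun h => absurd (hf (a₁ := 3) (a₂ := 5) h) (by decide)
  have hmn : m ≠ n := fun h => absurd (hf (a₁ := 4) (a₂ := 5) h) (by decide)
  set G : Tensor3 := fun x y z => levi ![i, j, k, x, y, z] * raise T x y z with hG
  have key : ∀ x y z, G x y z ≠ 0 → x = i ∨ x = j ∨ x = k → False := by
    rintro x y z h0 h
    apply h0
    rcases h with rfl | rfl | rfl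
    · simp only [hG, levi_eq_zero (f := ![x, j, k, x, y, z]) (show (0 : Fin 6) ≠ 3 by decide) rfl,
        zero_mul]
    · simp only [hG, levi_eq_zero (f := ![i, x, k, x, y, z]) (show (1 : Fin 6) ≠ 3 by decide) rfl,
        zero_mul]
    · simp only [hG, levi_eq_zero (f := ![i, j, x, x, y, z]) (show (2 : Fin 6) ≠ 3 by decide) rfl,
        zero_mul]
  have s1 : ∀ x y z, G y x z = G x y z := by
    intro x y z
    simp only [hG, levi_swap_fourth i j k x y z, raise, hT.1 x y z]
    ring
  have s2 : ∀ x y z, G x z y = G x y z := by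
    intro x y z
    simp only [hG, levi_swap_fifth i j k x y z, raise, hT.2 x y z]
    ring
  have z1 : ∀ x z, G x x z = 0 := by
    intro x z
    simp only [hG, raise, hT.eq_zero_left, mul_zero]
  have z2 : ∀ x z, G x z z = 0 := by
    intro x z
    simp only [hG, raise, hT.eq_zero_right, mul_zero]
  have z3 : ∀ x z, G x z x = 0 := by
    intro x z
    simp only [hG, raise, hT.eq_zero_outer, mul_zero]
  have supp : ∀ x y z, x ≠ l → x ≠ m → x ≠ n → G x y z = 0 := by
    intro x y z h1 h2 h3
    by_contra h0
    obtain ⟨a, ha⟩ := hsurj x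
    fin_cases a
    · exact key x y z h0 (Or.inl ha.symm)
    · exact key x y z h0 (Or.inr (Or.inl ha.symm))
    · exact key x y z h0 (Or.inr (Or.inr ha.symm))
    · exact h1 ha.symm
    · exact h2 ha.symm
    · exact h3 ha.symm
  -- The six orderings of `l, m, n` contribute equally.
  have hsum : ∑ x, ∑ y, ∑ z, G x y z = 6 * G l m n := by
    have e1 : ∀ x y, ∑ z, G x y z = G x y l + G x y m + G x y n := fun x y =>
      sum_eq_three hlm hln hmn _ fun z h1 h2 h3 => by
        rw [← s2, ← s1]
        exact supp z x y h1 h2 h3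
    have e2 : ∀ x, ∑ y, ∑ z, G x y z = ∑ z, G x l z + ∑ z, G x m z + ∑ z, G x n z := fun x =>
      sum_eq_three hlm hln hmn _ fun y h1 h2 h3 => Finset.sum_eq_zero fun z _ => by
        rw [← s1]
        exact supp y x z h1 h2 h3
    rw [sum_eq_three hlm hln hmn _ fun x h1 h2 h3 =>
      Finset.sum_eq_zero fun y _ => Finset.sum_eq_zero fun z _ => supp x y z h1 h2 h3]
    rw [e2, e2, e2]
    simp only [e1, z1, z2, z3]
    rw [s2 l m n, s1 l m n, s2 m l n, s1 l m n, s1 m n l, s2 m l n, s1 l m n, s1 l n m, s2 l m n]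
    ring
  have h6 : hodge T i j k = -(1 / 6) * ∑ x, ∑ y, ∑ z, G x y z := by
    simp only [hodge, hG, epsLower, epsUpper_eq_levi, neg_mul, Finset.sum_neg_distrib, mul_neg]
  rw [h6, hsum]
  simp only [hG, raise]
  ring

lemma injective_tuple {i j k l m n : Fin 6} : Function.Injective ![i, j, k, l, m, n] ↔
    (i ≠ j ∧ i ≠ k ∧ i ≠ l ∧ i ≠ m ∧ i ≠ n) ∧ (j ≠ k ∧ j ≠ l ∧ j ≠ m ∧ j ≠ n) ∧
      (k ≠ l ∧ k ≠ m ∧ k ≠ n) ∧ (l ≠ m ∧ l ≠ n) ∧ m ≠ n := by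
  simp only [Matrix.vecCons, Fin.cons_injective_iff, Set.mem_range, Fin.exists_fin_succ,
    Fin.cons_zero, Fin.cons_succ, not_or]
  simp [eq_comm, Function.injective_of_subsingleton]

/-- Three distinct indices can be completed to a permutation of all six. -/
lemma exists_complement_three : ∀ i j k : Fin 6, i ≠ j → i ≠ k → j ≠ k →
    ∃ l m n, Function.Injective ![i, j, k, l, m, n] := by
  intro i j k hij hik hjk
  have hc : ({i, j, k} : Finset (Fin 6))ᶜ.card = 3 := by
    rw [Finset.card_compl, Finset.card_eq_three.2 ⟨i, j, k, hij, hik, hjk, rfl⟩]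
    rfl
  obtain ⟨l, m, n, hlm, hln, hmn, hs⟩ := Finset.card_eq_three.1 hc
  have h : ∀ x, (x = l ∨ x = m ∨ x = n) → x ≠ i ∧ x ≠ j ∧ x ≠ k := by
    intro x hx
    have : x ∈ ({i, j, k} : Finset (Fin 6))ᶜ := by rw [hs]; simpa using hx
    simpa using this
  have hl := h l (Or.inl rfl)
  have hm := h m (Or.inr (Or.inl rfl))
  have hn := h n (Or.inr (Or.inr rfl))
  exact ⟨l, m, n, injective_tuple.2 ⟨⟨hij, hik, hl.1.symm, hm.1.symm, hn.1.symm⟩,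
    ⟨hjk, hl.2.1.symm, hm.2.1.symm, hn.2.1.symm⟩, ⟨hl.2.2.symm, hm.2.2.symm, hn.2.2.symm⟩,
    ⟨hlm, hln⟩, hmn⟩⟩

/-- To prove that two 3-forms agree, distinct indices suffice. -/
lemma IsThreeForm.ext {S T : Tensor3} (hS : IsThreeForm S) (hT : IsThreeForm T)
    (h : ∀ f : Fin 6 → Fin 6, Function.Injective f → S (f 0) (f 1) (f 2) = T (f 0) (f 1) (f 2)) :
    S = T := by
  funext i j k
  by_cases h1 : i = j
  · rw [h1, hS.eq_zero_left, hT.eq_zero_left]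
  by_cases h2 : i = k
  · rw [h2, hS.eq_zero_outer, hT.eq_zero_outer]
  by_cases h3 : j = k
  · rw [h3, hS.eq_zero_right, hT.eq_zero_right]
  obtain ⟨l, m, n, hf⟩ := exists_complement_three i j k h1 h2 h3
  exact h _ hf

lemma hodge_hodge {T : Tensor3} (hT : IsThreeForm T) : hodge (hodge T) = T := by
  refine (isThreeForm_hodge _).ext hT fun f hf => ?_
  rw [hodge_apply (isThreeForm_hodge T) hf]
  set σ : Equiv.Perm (Fin 6) := Equiv.swap 0 3 * Equiv.swap 1 4 * Equiv.swap 2 5 with hσ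
  have hs : Equiv.Perm.sign σ = -1 := by rw [hσ]; decide
  have h2 : hodge T (f 3) (f 4) (f 5) =
      -levi (f ∘ σ) * (eta (f 0) * eta (f 1) * eta (f 2) * T (f 0) (f 1) (f 2)) :=
    hodge_apply (f := f ∘ σ) hT (hf.comp σ.injective)
  rw [h2, levi_comp, hs]
  have e1 := levi_mul_self hf
  have e2 := prod_eta_comp hf
  push_cast
  linear_combination (-T (f 0) (f 1) (f 2)) * e2 * levi f * levi f + T (f 0) (f 1) (f 2) * e1

lemma wedge_hodge (S : Tensor3) {T : Tensor3} (hT : IsThreeForm T) :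
    wedge S (hodge T) = (1 / 6) * pair S T := by
  have := pair_hodge_eq_wedge S (hodge T)
  rw [hodge_hodge hT] at this
  linarith

lemma isSelfdual_add_hodge {T : Tensor3} (hT : IsThreeForm T) : IsSelfdual (T + hodge T) := by
  refine ⟨hT.add (isThreeForm_hodge T), ?_⟩
  rw [hodge_add, hodge_hodge hT, add_comm]

/-- The selfdual 3-forms as a subspace. -/
def selfdualForms : Submodule ℝ Tensor3 where
  carrier := {T | IsSelfdual T}
  add_mem' := by
    rintro S T ⟨h1, h2⟩ ⟨h3, h4⟩
    exact ⟨h1.add h3, by rw [hodge_add, h2, h4]⟩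
  zero_mem' := ⟨threeForms.zero_mem, hodge_zero⟩
  smul_mem' := by
    rintro c T ⟨h1, h2⟩
    exact ⟨h1.smul c, by rw [hodge_smul, h2]⟩

/-- A selfdual or antiselfdual 3-form is determined by its electric components `T_{0jk}`. -/
lemma eq_zero_of_electric {T : Tensor3} (hT : IsThreeForm T) {c : ℝ} (hc : c ≠ 0)
    (hd : hodge T = c • T) (h : ∀ j k, 0 < j → j < k → T 0 j k = 0) : T = 0 := by
  have h0 : ∀ j k, T 0 j k = 0 := by
    intro j k
    rcases (Fin.zero_le j).eq_or_lt with hj | hj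
    · rw [← hj, hT.eq_zero_left]
    rcases (Fin.zero_le k).eq_or_lt with hk | hk
    · rw [← hk, hT.eq_zero_outer]
    rcases lt_trichotomy j k with hjk | hjk | hjk
    · exact h j k hj hjk
    · rw [hjk, hT.eq_zero_right]
    · rw [hT.2, h k j hk hjk, neg_zero]
  have h1 : ∀ j k, T j 0 k = 0 := fun j k => by rw [hT.1, h0, neg_zero]
  have h2 : ∀ j k, T j k 0 = 0 := fun j k => by rw [hT.2, h1, neg_zero]
  refine hT.ext threeForms.zero_mem fun f hf => ?_
  obtain ⟨a, ha⟩ := Finite.injective_iff_surjective.1 hf 0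
  have dual : T (f 3) (f 4) (f 5) = 0 → T (f 0) (f 1) (f 2) = 0 := by
    intro e
    have e2 := hodge_apply hT hf
    rw [e, hd, mul_zero, mul_zero] at e2
    exact (mul_eq_zero.1 e2).resolve_left hc
  change T (f 0) (f 1) (f 2) = 0
  fin_cases a <;> simp only [Fin.zero_eta, Fin.mk_one, Fin.reduceFinMk] at ha
  · rw [ha, h0]
  · rw [ha, h1]
  · rw [ha, h2]
  · exact dual (by rw [ha, h0])
  · exact dual (by rw [ha, h1])
  · exact dual (by rw [ha, h2])

lemma IsSelfdual.ext {S T : Tensor3} (hS : IsSelfdual S) (hT : IsSelfdual T)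
    (h : ∀ j k, 0 < j → j < k → S 0 j k = T 0 j k) : S = T := by
  rw [← sub_eq_zero]
  refine eq_zero_of_electric (hS.1.sub hT.1) one_ne_zero ?_ fun j k hj hk => ?_
  · rw [hodge_sub, hS.2, hT.2, one_smul]
  · exact sub_eq_zero.2 (h j k hj hk)

/-- Selfduality can be read off from the electric components. -/
lemma isSelfdual_of_electric {T : Tensor3} (hT : IsThreeForm T)
    (h : ∀ j k, 0 < j → j < k → hodge T 0 j k = T 0 j k) : IsSelfdual T := by
  refine ⟨hT, ?_⟩
  rw [← sub_eq_zero]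
  refine eq_zero_of_electric (c := -1) ((isThreeForm_hodge T).sub hT) (by norm_num) ?_
    fun j k hj hk => sub_eq_zero.2 (h j k hj hk)
  rw [hodge_sub, hodge_hodge hT]
  funext i j k
  simp

/-! ### Lorentz covariance -/

lemma raise_raise (T : Tensor3) : raise (raise T) = T := by
  funext i j k
  simp only [raise]
  linear_combination (eta j * eta j * eta k * eta k * T i j k) * eta_mul_self i
    + (eta k * eta k * T i j k) * eta_mul_self j + T i j k * eta_mul_self k

lemma IsThreeForm.raise {T : Tensor3} (hT : IsThreeForm T) : IsThreeForm (raise T) := by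
  refine ⟨fun i j k => ?_, fun i j k => ?_⟩
  · simp only [Chiral6d.raise, hT.1 i j k]; ring
  · simp only [Chiral6d.raise, hT.2 i j k]; ring

/-- The pairing is nondegenerate, because `T_{ijk} T_{ijk}` is a sum of squares. -/
lemma eq_zero_of_pair_raise {T : Tensor3} (h : pair (raise T) T = 0) : T = 0 := by
  simp only [pair, raise_raise] at h
  have nn : ∀ i j k, 0 ≤ T i j k * T i j k := fun i j k => mul_self_nonneg _
  rw [Finset.sum_eq_zero_iff_of_nonneg fun i _ => Finset.sum_nonneg fun j _ =>
    Finset.sum_nonneg fun k _ => nn i j k] at h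
  funext i j k
  have h1 := h i (Finset.mem_univ i)
  rw [Finset.sum_eq_zero_iff_of_nonneg fun j _ => Finset.sum_nonneg fun k _ => nn i j k] at h1
  have h2 := h1 j (Finset.mem_univ j)
  rw [Finset.sum_eq_zero_iff_of_nonneg fun k _ => nn i j k] at h2
  exact mul_self_eq_zero.1 (h2 k (Finset.mem_univ k))

lemma act_add (L : Matrix (Fin 6) (Fin 6) ℝ) (S T : Tensor3) :
    act L (S + T) = act L S + act L T := by
  funext i j k
  simp only [act, Pi.add_apply, mul_add, Finset.sum_add_distrib]

lemma act_smul (L : Matrix (Fin 6) (Fin 6) ℝ) (c : ℝ) (T : Tensor3) :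
    act L (c • T) = c • act L T := by
  funext i j k
  simp only [act, Pi.smul_apply, smul_eq_mul, Finset.mul_sum]
  refine Finset.sum_congr rfl fun l _ => Finset.sum_congr rfl fun m _ =>
    Finset.sum_congr rfl fun n _ => ?_
  ring

/-- The action of a matrix on tensors as a linear map. -/
def actLin (L : Matrix (Fin 6) (Fin 6) ℝ) : Tensor3 →ₗ[ℝ] Tensor3 where
  toFun := act L
  map_add' := act_add L
  map_smul' := act_smul L

lemma act_one (T : Tensor3) : act 1 T = T := by
  funext i j k
  simp [act, Matrix.one_apply]

lemma sum_comm_two_two (G : Fin 6 → Fin 6 → Fin 6 → Fin 6 → ℝ) :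
    ∑ k, ∑ l, ∑ p, ∑ q, G k l p q = ∑ p, ∑ q, ∑ k, ∑ l, G k l p q := by
  have := Finset.sum_comm (s := (Finset.univ : Finset (Fin 6 × Fin 6)))
    (t := (Finset.univ : Finset (Fin 6 × Fin 6))) (f := fun s t => G s.1 s.2 t.1 t.2)
  simpa only [Fintype.sum_prod_type] using this

lemma sum_comm_three_three (G : Fin 6 → Fin 6 → Fin 6 → Fin 6 → Fin 6 → Fin 6 → ℝ) :
    ∑ i, ∑ j, ∑ k, ∑ p, ∑ q, ∑ r, G i j k p q r =
      ∑ p, ∑ q, ∑ r, ∑ i, ∑ j, ∑ k, G i j k p q r := by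
  have := Finset.sum_comm (s := (Finset.univ : Finset (Fin 6 × Fin 6 × Fin 6)))
    (t := (Finset.univ : Finset (Fin 6 × Fin 6 × Fin 6)))
    (f := fun s t => G s.1 s.2.1 s.2.2 t.1 t.2.1 t.2.2)
  simpa only [Fintype.sum_prod_type] using this

lemma act_eq (L : Matrix (Fin 6) (Fin 6) ℝ) (T : Tensor3) (i j k : Fin 6) :
    act L T i j k = ∑ q, L j q * ∑ r, L k r * ∑ p, L i p * T p q r := by
  simp only [act, Finset.mul_sum]
  rw [Finset.sum_comm]
  refine Finset.sum_congr rfl fun q _ => ?_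
  rw [Finset.sum_comm]
  refine Finset.sum_congr rfl fun r _ => Finset.sum_congr rfl fun p _ => ?_
  ring

lemma act_mul (L K : Matrix (Fin 6) (Fin 6) ℝ) (T : Tensor3) :
    act (L * K) T = act L (act K T) := by
  funext i j k
  have h : ∀ p q r, (L * K) i p * (L * K) j q * (L * K) k r * T p q r =
      ∑ x, ∑ y, ∑ z, L i x * L j y * L k z * (K x p * K y q * K z r * T p q r) := by
    intro p q r
    rw [Matrix.mul_apply, Matrix.mul_apply, Matrix.mul_apply, Finset.sum_mul_sum]
    simp only [Finset.sum_mul]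
    simp only [Finset.mul_sum, Finset.sum_mul]
    refine Finset.sum_congr rfl fun x _ => Finset.sum_congr rfl fun y _ =>
      Finset.sum_congr rfl fun z _ => ?_
    ring
  simp only [act, h, Finset.mul_sum]
  rw [sum_comm_three_three]

lemma IsThreeForm.act {T : Tensor3} (hT : IsThreeForm T) (L : Matrix (Fin 6) (Fin 6) ℝ) :
    IsThreeForm (act L T) := by
  refine ⟨fun i j k => ?_, fun i j k => ?_⟩
  · simp only [Chiral6d.act, ← Finset.sum_neg_distrib]
    rw [Finset.sum_comm]
    refine Finset.sum_congr rfl fun p _ => Finset.sum_congr rfl fun q _ =>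
      Finset.sum_congr rfl fun r _ => ?_
    rw [hT.1 p q r]
    ring
  · simp only [Chiral6d.act, ← Finset.sum_neg_distrib]
    refine Finset.sum_congr rfl fun p _ => ?_
    rw [Finset.sum_comm]
    refine Finset.sum_congr rfl fun q _ => Finset.sum_congr rfl fun r _ => ?_
    rw [hT.2 p q r]
    ring

lemma lorentz_contract {L : Matrix (Fin 6) (Fin 6) ℝ}
    (hL : L.transpose * etaMatrix * L = etaMatrix) (a b : Fin 6 → ℝ) :
    ∑ i, eta i * ((∑ p, L i p * a p) * ∑ q, L i q * b q) = ∑ p, eta p * (a p * b p) := by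
  have h : ∀ p q, ∑ i, eta i * (L i p * L i q) = if p = q then eta p else 0 := by
    intro p q
    have h1 := congrFun (congrFun hL p) q
    have h2 : ∀ i, (L.transpose * etaMatrix) p i = L i p * eta i := by
      intro i
      rw [etaMatrix, Matrix.mul_diagonal, Matrix.transpose_apply]
    rw [Matrix.mul_apply] at h1
    simp only [h2] at h1
    rw [etaMatrix, Matrix.diagonal_apply] at h1
    rw [← h1]
    refine Finset.sum_congr rfl fun i _ => ?_
    ring
  calc ∑ i, eta i * ((∑ p, L i p * a p) * ∑ q, L i q * b q)
      = ∑ p, ∑ q, (∑ i, eta i * (L i p * L i q)) * (a p * b q) := by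
        have e : ∀ i, eta i * ((∑ p, L i p * a p) * ∑ q, L i q * b q) =
            ∑ p, ∑ q, eta i * (L i p * L i q) * (a p * b q) := by
          intro i
          rw [Finset.sum_mul_sum]
          simp only [Finset.mul_sum]
          refine Finset.sum_congr rfl fun p _ => Finset.sum_congr rfl fun q _ => ?_
          ring
        rw [Finset.sum_congr rfl fun i _ => e i, Finset.sum_comm]
        refine Finset.sum_congr rfl fun p _ => ?_
        rw [Finset.sum_comm]
        simp only [Finset.sum_mul]
    _ = _ := by
        simp only [h, ite_mul, zero_mul, Finset.sum_ite_eq, Finset.mem_univ, if_true]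

/-- The contraction `S_{ikl} T_j^{kl}`. -/
def contraction (S T : Tensor3) : Matrix (Fin 6) (Fin 6) ℝ := Matrix.of fun i j =>
  ∑ k, eta k * ∑ l, eta l * (S i k l * T j k l)

lemma contraction_act {L : Matrix (Fin 6) (Fin 6) ℝ}
    (hL : L.transpose * etaMatrix * L = etaMatrix) (S T : Tensor3) :
    contraction (act L S) (act L T) = L * contraction S T * L.transpose := by
  ext i j
  have swap : ∀ X : Fin 6 → Fin 6 → ℝ,
      ∑ k, eta k * ∑ l, eta l * X k l = ∑ l, eta l * ∑ k, eta k * X k l := by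
    intro X
    simp only [Finset.mul_sum]
    rw [Finset.sum_comm]
    refine Finset.sum_congr rfl fun l _ => Finset.sum_congr rfl fun k _ => ?_
    ring
  have h : ∀ s t : Fin 6 → Fin 6 → ℝ,
      ∑ k, eta k * ∑ l, eta l * ((∑ q, L k q * ∑ r, L l r * s q r) *
        ∑ q, L k q * ∑ r, L l r * t q r) = ∑ k, eta k * ∑ l, eta l * (s k l * t k l) := by
    intro s t
    rw [swap]
    simp only [lorentz_contract hL (fun q => ∑ r, L _ r * s q r) (fun q => ∑ r, L _ r * t q r)]
    rw [swap]
    simp only [lorentz_contract hL]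
  have e : ∀ k l, eta k * (eta l * ((∑ p, L i p * S p k l) * ∑ q, L j q * T q k l)) =
      ∑ q, ∑ p, L i p * (eta k * (eta l * (S p k l * T q k l))) * L j q := by
    intro k l
    rw [Finset.sum_mul_sum, Finset.sum_comm]
    simp only [Finset.mul_sum]
    refine Finset.sum_congr rfl fun q _ => Finset.sum_congr rfl fun p _ => ?_
    ring
  simp only [contraction, Matrix.of_apply, act_eq, Matrix.mul_apply, Matrix.transpose_apply]
  rw [h (fun q r => ∑ p, L i p * S p q r) (fun q r => ∑ p, L j p * T p q r)]
  rw [Finset.sum_congr rfl fun k _ => (Finset.mul_sum _ _ _).trans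
    (Finset.sum_congr rfl fun l _ => e k l), sum_comm_two_two]
  simp only [Finset.mul_sum, Finset.sum_mul]

lemma pair_eq_trace (S T : Tensor3) : pair S T = (etaMatrix * contraction S T).trace := by
  simp only [pair, raise, Matrix.trace, Matrix.diag, etaMatrix, Matrix.diagonal_mul, contraction,
    Matrix.of_apply, Finset.mul_sum]
  refine Finset.sum_congr rfl fun i _ => Finset.sum_congr rfl fun j _ =>
    Finset.sum_congr rfl fun k _ => ?_
  ring

lemma I4_eq_trace (T : Tensor3) :
    I4 T = (contraction T T * etaMatrix * (contraction T T * etaMatrix)).trace := by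
  have h : ∀ i j, tensorM T i j = (contraction T T * etaMatrix) i j := by
    intro i j
    simp only [tensorM, raise, contraction, etaMatrix, Matrix.mul_diagonal, Matrix.of_apply,
      Finset.mul_sum, Finset.sum_mul]
    refine Finset.sum_congr rfl fun j _ => Finset.sum_congr rfl fun k _ => ?_
    ring
  simp only [I4, h, Matrix.trace, Matrix.diag, Matrix.mul_apply (M := contraction T T * etaMatrix)]

lemma pair_act {L : Matrix (Fin 6) (Fin 6) ℝ} (hL : L.transpose * etaMatrix * L = etaMatrix)
    (S T : Tensor3) : pair (act L S) (act L T) = pair S T := by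
  rw [pair_eq_trace, pair_eq_trace, contraction_act hL]
  conv_rhs => rw [← hL]
  rw [← Matrix.mul_assoc, ← Matrix.mul_assoc, Matrix.trace_mul_comm]
  simp only [Matrix.mul_assoc]

lemma I4_act {L : Matrix (Fin 6) (Fin 6) ℝ} (hL : L.transpose * etaMatrix * L = etaMatrix)
    (T : Tensor3) : I4 (act L T) = I4 T := by
  rw [I4_eq_trace, I4_eq_trace, contraction_act hL]
  set A := contraction T T
  calc (L * A * L.transpose * etaMatrix * (L * A * L.transpose * etaMatrix)).trace
      = (L * (A * (L.transpose * etaMatrix * L) * (A * (L.transpose * etaMatrix)))).trace := by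
        simp only [Matrix.mul_assoc]
    _ = (A * (L.transpose * etaMatrix * L) * (A * (L.transpose * etaMatrix * L))).trace := by
        rw [Matrix.trace_mul_comm]
        simp only [Matrix.mul_assoc]
    _ = _ := by rw [hL]

lemma wedge_act (L : Matrix (Fin 6) (Fin 6) ℝ) (S T : Tensor3) :
    wedge (act L S) (act L T) = L.det * wedge S T := by
  have h : ∀ f : Fin 6 → Fin 6, act L S (f 0) (f 1) (f 2) * act L T (f 3) (f 4) (f 5) =
      ∑ p : Fin 6 → Fin 6, (∏ a, L.transpose (p a) (f a)) *
        (S (p 0) (p 1) (p 2) * T (p 3) (p 4) (p 5)) := by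
    intro f
    rw [sum_fun_six]
    simp only [act, Finset.sum_mul]
    simp only [Finset.mul_sum]
    refine Finset.sum_congr rfl fun i _ => Finset.sum_congr rfl fun j _ =>
      Finset.sum_congr rfl fun k _ => Finset.sum_congr rfl fun l _ =>
      Finset.sum_congr rfl fun m _ => Finset.sum_congr rfl fun n _ => ?_
    rw [Fin.prod_univ_six]
    change _ = L (f 0) i * L (f 1) j * L (f 2) k * L (f 3) l * L (f 4) m * L (f 5) n *
      (S i j k * T l m n)
    ring
  rw [wedge_eq_sum, wedge_eq_sum]
  simp only [h, Finset.mul_sum]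
  rw [Finset.sum_comm]
  refine Finset.sum_congr rfl fun p _ => ?_
  have := sum_levi_mul_prod L.transpose p
  rw [Matrix.det_transpose] at this
  rw [show L.det * (1 / 36 * (levi p * (S (p 0) (p 1) (p 2) * T (p 3) (p 4) (p 5)))) =
    (1 / 36) * (L.det * levi p) * (S (p 0) (p 1) (p 2) * T (p 3) (p 4) (p 5)) by ring, ← this,
    Finset.mul_sum, Finset.sum_mul]
  refine Finset.sum_congr rfl fun f _ => ?_
  ring

lemma etaMatrix_mul_self : etaMatrix * etaMatrix = 1 := by
  simp only [etaMatrix, Matrix.diagonal_mul_diagonal, eta_mul_self, Matrix.diagonal_one]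

lemma IsLorentz.inv_mul {L : Matrix (Fin 6) (Fin 6) ℝ} (hL : IsLorentz L) :
    etaMatrix * L.transpose * etaMatrix * L = 1 := by
  rw [Matrix.mul_assoc, Matrix.mul_assoc, ← Matrix.mul_assoc L.transpose, hL.1,
    etaMatrix_mul_self]

/-- A Lorentz transformation has an inverse action on tensors. -/
lemma IsLorentz.exists_act_eq {L : Matrix (Fin 6) (Fin 6) ℝ} (hL : IsLorentz L) (T : Tensor3) :
    ∃ S, act L S = T := by
  refine ⟨act (etaMatrix * L.transpose * etaMatrix) T, ?_⟩
  rw [← act_mul, mul_eq_one_comm.1 hL.inv_mul, act_one]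

lemma IsLorentz.act_injective {L : Matrix (Fin 6) (Fin 6) ℝ} (hL : IsLorentz L) {S T : Tensor3}
    (h : act L S = act L T) : S = T := by
  rw [← act_one S, ← act_one T, ← hL.inv_mul, act_mul _ L, act_mul _ L, h]

/-- The Hodge star is Lorentz covariant: `6 wedge S T = pair S (hodge T)` with a nondegenerate
invariant pairing, and the wedge product only changes by `det L = 1`. -/
lemma hodge_act {L : Matrix (Fin 6) (Fin 6) ℝ} (hL : IsLorentz L) (T : Tensor3) :
    hodge (act L T) = act L (hodge T) := by
  rw [← sub_eq_zero]
  apply eq_zero_of_pair_raise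
  obtain ⟨S, hS⟩ := hL.exists_act_eq (raise (hodge (act L T) - act L (hodge T)))
  rw [← hS, pair_sub_right, pair_act hL.1, pair_hodge_eq_wedge, pair_hodge_eq_wedge, wedge_act,
    hL.2.1, one_mul, sub_self]

lemma IsSelfdual.act {Y : Tensor3} (hY : IsSelfdual Y) {L : Matrix (Fin 6) (Fin 6) ℝ}
    (hL : IsLorentz L) : IsSelfdual (act L Y) :=
  ⟨hY.1.act L, by rw [hodge_act hL, hY.2]⟩

lemma IsLorentz.exists_selfdual_act_eq {L : Matrix (Fin 6) (Fin 6) ℝ} (hL : IsLorentz L)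
    {W : Tensor3} (hW : IsSelfdual W) : ∃ V, IsSelfdual V ∧ Chiral6d.act L V = W := by
  obtain ⟨V, rfl⟩ := hL.exists_act_eq W
  refine ⟨V, ⟨?_, hL.act_injective ?_⟩, rfl⟩
  · have := hW.1.act (etaMatrix * L.transpose * etaMatrix)
    rwa [← act_mul, hL.inv_mul, act_one] at this
  · rw [← hodge_act hL, hW.2]

/-! ### The derivative with respect to a 3-form -/

lemma unitForm_apply (i j k a b c : Fin 6) : unitForm i j k a b c = (1 / 6) *
    ((1 : Matrix (Fin 6) (Fin 6) ℝ) i a * (1 : Matrix (Fin 6) (Fin 6) ℝ) j b *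
        (1 : Matrix (Fin 6) (Fin 6) ℝ) k c
      - (1 : Matrix (Fin 6) (Fin 6) ℝ) i a * (1 : Matrix (Fin 6) (Fin 6) ℝ) j c *
        (1 : Matrix (Fin 6) (Fin 6) ℝ) k b
      - (1 : Matrix (Fin 6) (Fin 6) ℝ) i b * (1 : Matrix (Fin 6) (Fin 6) ℝ) j a *
        (1 : Matrix (Fin 6) (Fin 6) ℝ) k c
      + (1 : Matrix (Fin 6) (Fin 6) ℝ) i b * (1 : Matrix (Fin 6) (Fin 6) ℝ) j c *
        (1 : Matrix (Fin 6) (Fin 6) ℝ) k a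
      + (1 : Matrix (Fin 6) (Fin 6) ℝ) i c * (1 : Matrix (Fin 6) (Fin 6) ℝ) j a *
        (1 : Matrix (Fin 6) (Fin 6) ℝ) k b
      - (1 : Matrix (Fin 6) (Fin 6) ℝ) i c * (1 : Matrix (Fin 6) (Fin 6) ℝ) j b *
        (1 : Matrix (Fin 6) (Fin 6) ℝ) k a) := by
  rw [unitForm, Matrix.det_fin_three]
  rfl

lemma isThreeForm_formDeriv (f : Tensor3 → ℝ) (Y : Tensor3) : IsThreeForm (formDeriv f Y) := by
  have h1 : ∀ i j k, unitForm j i k = -unitForm i j k := by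
    intro i j k
    funext a b c
    simp only [unitForm_apply, Pi.neg_apply]
    ring
  have h2 : ∀ i j k, unitForm i k j = -unitForm i j k := by
    intro i j k
    funext a b c
    simp only [unitForm_apply, Pi.neg_apply]
    ring
  refine ⟨fun i j k => ?_, fun i j k => ?_⟩
  · simp only [formDeriv, h1 i j k, map_neg]; ring
  · simp only [formDeriv, h2 i j k, map_neg]; ring

lemma sum_unitForm {W : Tensor3} (hW : IsThreeForm W) :
    ∑ i, ∑ j, ∑ k, W i j k • unitForm i j k = W := by
  funext a b c
  have h : ∀ x y z : Fin 6, ∑ i, ∑ j, ∑ k, W i j k * ((1 : Matrix (Fin 6) (Fin 6) ℝ) i x *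
      (1 : Matrix (Fin 6) (Fin 6) ℝ) j y * (1 : Matrix (Fin 6) (Fin 6) ℝ) k z) = W x y z := by
    intro x y z
    simp [Matrix.one_apply]
  simp only [Finset.sum_apply, Pi.smul_apply, smul_eq_mul, unitForm_apply, mul_left_comm _ (1 / 6 : ℝ)]
  simp only [← Finset.mul_sum, mul_add, mul_sub, Finset.sum_add_distrib, Finset.sum_sub_distrib]
  rw [h, h, h, h, h, h, hW.2 a b c, hW.1 a b c, hW.cycle a b c, ← hW.cycle c a b,
    hW.2 c a b, ← hW.cycle c a b]
  ring

/-- The defining property of the derivative with respect to a 3-form. -/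
lemma pair_formDeriv (f : Tensor3 → ℝ) (Y : Tensor3) {W : Tensor3} (hW : IsThreeForm W) :
    pair (formDeriv f Y) W = fderiv ℝ f Y W := by
  conv_rhs => rw [← sum_unitForm hW]
  simp only [map_sum, map_smul, smul_eq_mul, pair]
  refine Finset.sum_congr rfl fun i _ => Finset.sum_congr rfl fun j _ =>
    Finset.sum_congr rfl fun k _ => ?_
  have := congrFun (congrFun (congrFun (raise_raise fun i j k => fderiv ℝ f Y (unitForm i j k)) i) j) k
  rw [← this, mul_comm]
  rfl

lemma contDiff_I4 : ContDiff ℝ ∞ I4 := by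
  unfold I4 tensorM raise
  fun_prop

lemma contDiff_eval_I4 (F : Polynomial ℝ) : ContDiff ℝ ∞ fun T => F.eval (I4 T) := by
  have : ContDiff ℝ ∞ fun x : ℝ => F.eval x := by
    simpa using F.contDiff_aeval (𝕜 := ℝ) (n := ∞)
  exact this.comp contDiff_I4

lemma isThreeForm_tensorX (F : Polynomial ℝ) (Y : Tensor3) : IsThreeForm (tensorX F Y) :=
  isThreeForm_formDeriv _ Y

lemma pair_tensorX (F : Polynomial ℝ) (Y : Tensor3) {W : Tensor3} (hW : IsThreeForm W) :
    pair (tensorX F Y) W = F.derivative.eval (I4 Y) * fderiv ℝ I4 Y W := by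
  have h : HasFDerivAt (fun T => F.eval (I4 T)) (F.derivative.eval (I4 Y) • fderiv ℝ I4 Y) Y :=
    (F.hasDerivAt (I4 Y)).comp_hasFDerivAt Y
      (contDiff_I4.differentiable (by simp) Y).hasFDerivAt
  rw [tensorX, pair_formDeriv _ Y hW, h.fderiv]
  rfl

/-- The differential of the Lorentz invariant `I₄` is covariant. -/
lemma fderiv_I4_act {L : Matrix (Fin 6) (Fin 6) ℝ} (hL : L.transpose * etaMatrix * L = etaMatrix)
    (Y W : Tensor3) : fderiv ℝ I4 (act L Y) (act L W) = fderiv ℝ I4 Y W := by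
  have h1 : HasFDerivAt I4 (fderiv ℝ I4 (act L Y)) (LinearMap.toContinuousLinearMap (actLin L) Y) :=
    (contDiff_I4.differentiable (by simp) (act L Y)).hasFDerivAt
  have h2 := h1.comp Y (LinearMap.toContinuousLinearMap (actLin L)).hasFDerivAt
  have h3 : I4 ∘ (LinearMap.toContinuousLinearMap (actLin L)) = I4 := funext fun T => I4_act hL T
  rw [h3] at h2
  rw [h2.fderiv]
  rfl

/-! ### Normal form of skew-symmetric matrices in dimension five -/

/-- A skew-adjoint map preserves the plane spanned by two suitable orthonormal vectors: an
eigenvector `x` of its square and the direction of its image. -/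
lemma exists_invariant_plane {E : Type*} [NormedAddCommGroup E] [InnerProductSpace ℝ E]
    [FiniteDimensional ℝ E] (hE : 2 ≤ Module.finrank ℝ E) (A : E →ₗ[ℝ] E)
    (hA : ∀ x y, inner ℝ (A x) y = -inner ℝ x (A y)) :
    ∃ x y : E, ‖x‖ = 1 ∧ ‖y‖ = 1 ∧ inner ℝ x y = 0 ∧
      ∀ z, inner ℝ x z = 0 → inner ℝ y z = 0 → inner ℝ (A x) z = 0 ∧ inner ℝ (A y) z = 0 := by
  have hself : ∀ x, inner ℝ x (A x) = 0 := by
    intro x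
    have := hA x x
    rw [real_inner_comm] at this
    linarith
  have hT : (A ∘ₗ A).IsSymmetric := by
    intro x y
    simp only [LinearMap.comp_apply]
    rw [hA, hA, neg_neg]
  set b := hT.eigenvectorBasis rfl with hb
  by_cases h0 : ∃ i, A (b i) ≠ 0
  · obtain ⟨i, hi⟩ := h0
    have hn : ‖A (b i)‖ ≠ 0 := norm_ne_zero_iff.2 hi
    have hsq : A (A (b i)) = hT.eigenvalues rfl i • b i := by
      exact hT.apply_eigenvectorBasis rfl i
    refine ⟨b i, ‖A (b i)‖⁻¹ • A (b i), b.orthonormal.1 i, ?_, ?_, fun z hx hy => ⟨?_, ?_⟩⟩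
    · rw [norm_smul, norm_inv, norm_norm, inv_mul_cancel₀ hn]
    · rw [inner_smul_right, hself, mul_zero]
    · rw [inner_smul_left] at hy
      simpa [hn] using hy
    · rw [map_smul, hsq, inner_smul_left, inner_smul_left, hx, mul_zero, mul_zero]
  · push Not at h0
    have hz : A = 0 := b.toBasis.ext fun i => by simpa using h0 i
    refine ⟨b ⟨0, by omega⟩, b ⟨1, by omega⟩, b.orthonormal.1 _, b.orthonormal.1 _,
      b.orthonormal.2 (by simp), fun z _ _ => ?_⟩
    simp [hz]

/-- The skew-symmetric matrix with blocks `x`, `y` in the coordinate planes `01` and `23`. -/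
def skewBlock (x y : ℝ) : Matrix (Fin 5) (Fin 5) ℝ :=
  !![0, x, 0, 0, 0; -x, 0, 0, 0, 0; 0, 0, 0, y, 0; 0, 0, -y, 0, 0; 0, 0, 0, 0, 0]

/-- Two orthogonal invariant planes in an adapted orthonormal frame. -/
lemma exists_adapted_frame (A : EuclideanSpace ℝ (Fin 5) →ₗ[ℝ] EuclideanSpace ℝ (Fin 5))
    (hA : ∀ x y, inner ℝ (A x) y = -inner ℝ x (A y)) :
    ∃ e : Fin 5 → EuclideanSpace ℝ (Fin 5), Orthonormal ℝ e ∧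
      ∃ x y, ∀ i j, inner ℝ (e i) (A (e j)) = skewBlock x y i j := by
  obtain ⟨x₁, y₁, hx₁, hy₁, hxy₁, h₁⟩ := exists_invariant_plane (by simp) A hA
  set K : Submodule ℝ (EuclideanSpace ℝ (Fin 5)) := Submodule.span ℝ {x₁, y₁} with hK
  have hmem : ∀ z, z ∈ Kᗮ ↔ inner ℝ x₁ z = 0 ∧ inner ℝ y₁ z = 0 := by
    intro z
    rw [hK, Submodule.mem_orthogonal]
    constructor
    · intro h
      exact ⟨h _ (Submodule.subset_span (by simp)), h _ (Submodule.subset_span (by simp))⟩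
    · rintro ⟨h1, h2⟩ u hu
      obtain ⟨a, b, rfl⟩ := Submodule.mem_span_pair.1 hu
      simp [inner_add_left, inner_smul_left, h1, h2]
  have hKdim : Module.finrank ℝ K ≤ 2 := by
    have := finrank_span_le_card (R := ℝ) ({x₁, y₁} : Set (EuclideanSpace ℝ (Fin 5)))
    refine this.trans ?_
    rw [Set.toFinset_insert, Set.toFinset_singleton]
    exact Finset.card_le_two
  have hdim : 2 ≤ Module.finrank ℝ Kᗮ := by
    have := K.finrank_add_finrank_orthogonal
    rw [finrank_euclideanSpace_fin] at this
    omega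
  have hinv : ∀ z ∈ Kᗮ, A z ∈ Kᗮ := by
    intro z hz
    rw [hmem] at hz ⊢
    obtain ⟨h2, h3⟩ := h₁ z hz.1 hz.2
    rw [hA] at h2 h3
    exact ⟨by linarith, by linarith⟩
  obtain ⟨x₂, y₂, hx₂, hy₂, hxy₂, h₂⟩ := exists_invariant_plane hdim (A.restrict hinv)
    (fun x y => hA x y)
  have hx₂' := (hmem x₂).1 x₂.2
  have hy₂' := (hmem y₂).1 y₂.2
  have h₂' : ∀ z, z ∈ Kᗮ → inner ℝ (x₂ : EuclideanSpace ℝ (Fin 5)) z = 0 →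
      inner ℝ (y₂ : EuclideanSpace ℝ (Fin 5)) z = 0 →
      inner ℝ (A x₂) z = 0 ∧ inner ℝ (A y₂) z = 0 := fun z hz h3 h4 => h₂ ⟨z, hz⟩ h3 h4
  obtain ⟨z, hz1, hz⟩ : ∃ z : EuclideanSpace ℝ (Fin 5), ‖z‖ = 1 ∧
      ∀ u ∈ ({x₁, y₁, (x₂ : EuclideanSpace ℝ (Fin 5)), (y₂ : EuclideanSpace ℝ (Fin 5))} :
        Set (EuclideanSpace ℝ (Fin 5))), inner ℝ u z = 0 := by
    set J : Submodule ℝ (EuclideanSpace ℝ (Fin 5)) := Submodule.span ℝ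
      (({x₁, y₁, (x₂ : EuclideanSpace ℝ (Fin 5)), (y₂ : EuclideanSpace ℝ (Fin 5))} : Finset _) :
        Set (EuclideanSpace ℝ (Fin 5))) with hJ
    have hJdim : Module.finrank ℝ J ≤ 4 :=
      (finrank_span_finset_le_card _).trans Finset.card_le_four
    have hJo : 0 < Module.finrank ℝ Jᗮ := by
      have := J.finrank_add_finrank_orthogonal
      rw [finrank_euclideanSpace_fin] at this
      omega
    have : Nontrivial Jᗮ := Module.finrank_pos_iff.1 hJo
    obtain ⟨w, hw⟩ := exists_ne (0 : Jᗮ)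
    have hw0 : ‖(w : EuclideanSpace ℝ (Fin 5))‖ ≠ 0 := by simpa using hw
    refine ⟨‖(w : EuclideanSpace ℝ (Fin 5))‖⁻¹ • (w : EuclideanSpace ℝ (Fin 5)), ?_, fun u hu => ?_⟩
    · rw [norm_smul, norm_inv, norm_norm, inv_mul_cancel₀ hw0]
    · rw [inner_smul_right, (Submodule.mem_orthogonal _ _).1 w.2 u
        (Submodule.subset_span (by simpa using hu)), mul_zero]
  have z1 := hz x₁ (by simp)
  have z2 := hz y₁ (by simp)
  have z3 := hz x₂ (by simp)
  have z4 := hz y₂ (by simp)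
  have hself : ∀ x, inner ℝ x (A x) = 0 := by
    intro x
    have := hA x x
    rw [real_inner_comm] at this
    linarith
  have hskew : ∀ u v, inner ℝ u (A v) = 0 → inner ℝ v (A u) = 0 := by
    intro u v h
    rw [real_inner_comm, hA, h, neg_zero]
  have hzK : z ∈ Kᗮ := (hmem z).2 ⟨z1, z2⟩
  have a1 : inner ℝ (x₂ : EuclideanSpace ℝ (Fin 5)) (A x₁) = 0 := by
    rw [real_inner_comm]; exact (h₁ _ hx₂'.1 hx₂'.2).1
  have a2 : inner ℝ (x₂ : EuclideanSpace ℝ (Fin 5)) (A y₁) = 0 := by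
    rw [real_inner_comm]; exact (h₁ _ hx₂'.1 hx₂'.2).2
  have a3 : inner ℝ (y₂ : EuclideanSpace ℝ (Fin 5)) (A x₁) = 0 := by
    rw [real_inner_comm]; exact (h₁ _ hy₂'.1 hy₂'.2).1
  have a4 : inner ℝ (y₂ : EuclideanSpace ℝ (Fin 5)) (A y₁) = 0 := by
    rw [real_inner_comm]; exact (h₁ _ hy₂'.1 hy₂'.2).2
  have a5 : inner ℝ z (A x₁) = 0 := by rw [real_inner_comm]; exact (h₁ _ z1 z2).1
  have a6 : inner ℝ z (A y₁) = 0 := by rw [real_inner_comm]; exact (h₁ _ z1 z2).2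
  have a7 : inner ℝ z (A x₂) = 0 := by rw [real_inner_comm]; exact (h₂' _ hzK z3 z4).1
  have a8 : inner ℝ z (A y₂) = 0 := by rw [real_inner_comm]; exact (h₂' _ hzK z3 z4).2
  have hx₂n : ‖(x₂ : EuclideanSpace ℝ (Fin 5))‖ = 1 := hx₂
  have hy₂n : ‖(y₂ : EuclideanSpace ℝ (Fin 5))‖ = 1 := hy₂
  have hxy₂n : inner ℝ (x₂ : EuclideanSpace ℝ (Fin 5)) (y₂ : EuclideanSpace ℝ (Fin 5)) = 0 := hxy₂
  refine ⟨![x₁, y₁, x₂, y₂, z], ?_, inner ℝ x₁ (A y₁),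
    inner ℝ (x₂ : EuclideanSpace ℝ (Fin 5)) (A y₂), fun i j => ?_⟩
  · rw [orthonormal_iff_ite]
    have sy : ∀ u v : EuclideanSpace ℝ (Fin 5), inner ℝ u v = 0 → inner ℝ v u = 0 :=
      fun u v h => by rw [real_inner_comm, h]
    intro i j
    fin_cases i <;> fin_cases j <;>
      simp [hx₁, hy₁, hxy₁, hx₂n, hy₂n, hxy₂n, hx₂'.1, hx₂'.2, hy₂'.1, hy₂'.2, z1, z2, z3, z4, hz1,
        sy _ _ hxy₁, sy _ _ hxy₂n, sy _ _ hx₂'.1, sy _ _ hx₂'.2, sy _ _ hy₂'.1, sy _ _ hy₂'.2,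
        sy _ _ z1, sy _ _ z2, sy _ _ z3, sy _ _ z4]
  · have b1 : inner ℝ y₁ (A x₁) = -inner ℝ x₁ (A y₁) := by rw [real_inner_comm, hA]
    have b2 : inner ℝ (y₂ : EuclideanSpace ℝ (Fin 5)) (A x₂) =
        -inner ℝ (x₂ : EuclideanSpace ℝ (Fin 5)) (A y₂) := by rw [real_inner_comm, hA]
    fin_cases i <;> fin_cases j <;>
      simp [skewBlock, hself, a1, a2, a3, a4, a5, a6, a7, a8, b1, b2,
        hskew _ _ a1, hskew _ _ a2, hskew _ _ a3, hskew _ _ a4, hskew _ _ a5, hskew _ _ a6,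
        hskew _ _ a7, hskew _ _ a8]

/-- A real skew-symmetric matrix of size five is brought to block form by a rotation. -/
lemma exists_rotation_skewBlock (B : Matrix (Fin 5) (Fin 5) ℝ) (hB : ∀ i j, B j i = -B i j) :
    ∃ O : Matrix (Fin 5) (Fin 5) ℝ, O.transpose * O = 1 ∧ O.det = 1 ∧
      ∃ x y, B = O * skewBlock x y * O.transpose := by
  have hBt : B.transpose = -B := by ext i j; exact hB i j
  have hin : ∀ u v : EuclideanSpace ℝ (Fin 5), inner ℝ u (Matrix.toEuclideanLin B v) =
      dotProduct u.ofLp (B.mulVec v.ofLp) := by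
    intro u v
    rw [EuclideanSpace.inner_eq_star_dotProduct, dotProduct_comm]
    simp
  obtain ⟨e, he, x, y, hxy⟩ := exists_adapted_frame (Matrix.toEuclideanLin B) (by
    intro u v
    rw [real_inner_comm, hin, hin, Matrix.dotProduct_mulVec, ← Matrix.mulVec_transpose, hBt,
      Matrix.neg_mulVec, neg_dotProduct, dotProduct_comm])
  set O : Matrix (Fin 5) (Fin 5) ℝ := Matrix.of fun a i => e i a with hO
  have h1 : O.transpose * O = 1 := by
    ext i j
    have := orthonormal_iff_ite.1 he i j
    rw [EuclideanSpace.inner_eq_star_dotProduct, dotProduct_comm] at this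
    rw [Matrix.one_apply, ← this]
    simp [hO, Matrix.mul_apply, dotProduct]
  have h2 : O.transpose * B * O = skewBlock x y := by
    ext i j
    rw [← hxy, hin, Matrix.mul_assoc]
    simp [hO, Matrix.mul_apply, dotProduct, Matrix.mulVec]
  have h3 : O * O.transpose = 1 := mul_eq_one_comm.1 h1
  have hdet : O.det * O.det = 1 := by
    have := congrArg Matrix.det h1
    rwa [Matrix.det_mul, Matrix.det_transpose, Matrix.det_one] at this
  -- The block form does not see the sign of the last frame vector, which can therefore be used
  -- to make the determinant one.
  set D : Matrix (Fin 5) (Fin 5) ℝ := Matrix.diagonal ![1, 1, 1, 1, O.det] with hD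
  have hDD : D * D = 1 := by
    rw [hD, Matrix.diagonal_mul_diagonal, ← Matrix.diagonal_one]
    congr 1
    funext i
    fin_cases i <;> simp [hdet]
  have hDt : D.transpose = D := by rw [hD, Matrix.diagonal_transpose]
  have hDS : D * skewBlock x y * D = skewBlock x y := by
    ext i j
    rw [hD, Matrix.mul_diagonal, Matrix.diagonal_mul]
    fin_cases i <;> fin_cases j <;> simp [skewBlock]
  refine ⟨O * D, ?_, ?_, x, y, ?_⟩
  · rw [Matrix.transpose_mul, hDt, Matrix.mul_assoc, ← Matrix.mul_assoc O.transpose, h1,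
      Matrix.one_mul, hDD]
  · rw [Matrix.det_mul, hD, Matrix.det_diagonal, Fin.prod_univ_five]
    simpa using hdet
  · rw [Matrix.transpose_mul, hDt]
    calc B = O * O.transpose * B * (O * O.transpose) := by rw [h3, Matrix.one_mul, Matrix.mul_one]
      _ = O * (O.transpose * B * O) * O.transpose := by simp only [Matrix.mul_assoc]
      _ = O * (D * skewBlock x y * D) * O.transpose := by rw [h2, hDS]
      _ = _ := by simp only [Matrix.mul_assoc]

/-! ### The normal form of a selfdual 3-form -/

/-- The components of the 3-form `dx^a ∧ dx^b ∧ dx^c`, as integers. -/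
def coordForm (a b c i j k : Fin 6) : ℤ :=
  let δ : Fin 6 → Fin 6 → ℤ := fun x y => if x = y then 1 else 0
  δ a i * (δ b j * δ c k - δ b k * δ c j) + δ a j * (δ b k * δ c i - δ b i * δ c k)
    + δ a k * (δ b i * δ c j - δ b j * δ c i)

/-- The components of `dx^0 ∧ dx^1 ∧ dx^2` plus its Hodge dual. -/
def basisOne (i j k : Fin 6) : ℤ := coordForm 0 1 2 i j k - coordForm 5 3 4 i j k

/-- The components of `dx^0 ∧ dx^3 ∧ dx^4` plus its Hodge dual. -/
def basisTwo (i j k : Fin 6) : ℤ := coordForm 0 3 4 i j k - coordForm 5 1 2 i j k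

/-- The selfdual 3-form
`u (dx^0 - dx^5) ∧ (dx^1 ∧ dx^2 + dx^3 ∧ dx^4) + v (dx^0 + dx^5) ∧ (dx^1 ∧ dx^2 - dx^3 ∧ dx^4)`. -/
def normalForm (u v : ℝ) : Tensor3 := fun i j k =>
  (u + v) * (basisOne i j k : ℝ) + (u - v) * (basisTwo i j k : ℝ)

lemma coordForm_symm (a b c i j k : Fin 6) : coordForm a b c j i k = -coordForm a b c i j k ∧
    coordForm a b c i k j = -coordForm a b c i j k := by
  constructor <;> (simp only [coordForm]; ring)

lemma isThreeForm_normalForm (u v : ℝ) : IsThreeForm (normalForm u v) := by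
  constructor <;> intro i j k
  · simp only [normalForm, basisOne, basisTwo, (coordForm_symm _ _ _ i j k).1]
    push_cast; ring
  · simp only [normalForm, basisOne, basisTwo, (coordForm_symm _ _ _ i j k).2]
    push_cast; ring

lemma levi_eq_of_sign {f : Fin 6 → Fin 6} (hf : Function.Bijective f) {s : ℤˣ}
    (h : Equiv.Perm.sign (Equiv.ofBijective f hf) = s) : levi f = (s : ℤ) := by
  have : levi f = levi (id ∘ Equiv.ofBijective f hf) := rfl
  rw [this, levi_comp, levi_id, mul_one, h]

/-- An electric component `0jk` of the Hodge dual of the normal form, computed from the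
complementary component `lmn`. -/
lemma hodge_normalForm_apply (u v : ℝ) {j k l m n : Fin 6}
    (hf : Function.Bijective ![0, j, k, l, m, n]) (s : ℤˣ)
    (hs : Equiv.Perm.sign (Equiv.ofBijective _ hf) = s)
    (h₁ : basisOne 0 j k = -s * basisOne l m n) (h₂ : basisTwo 0 j k = -s * basisTwo l m n) :
    hodge (normalForm u v) 0 j k = normalForm u v 0 j k := by
  have hne := (injective_tuple.1 hf.1).1
  have e := hodge_apply (isThreeForm_normalForm u v) hf.1
  change hodge (normalForm u v) 0 j k =
    -levi _ * (eta l * eta m * eta n * normalForm u v l m n) at e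
  rw [e, levi_eq_of_sign hf hs]
  have e1 : (basisOne 0 j k : ℝ) = -((s : ℤ) : ℝ) * (basisOne l m n : ℝ) := by
    rw [h₁]; push_cast; ring
  have e2 : (basisTwo 0 j k : ℝ) = -((s : ℤ) : ℝ) * (basisTwo l m n : ℝ) := by
    rw [h₂]; push_cast; ring
  simp only [normalForm, e1, e2, eta, if_neg hne.2.2.1.symm, if_neg hne.2.2.2.1.symm,
    if_neg hne.2.2.2.2.symm]
  ring

/-- The ten independent electric index pairs. -/
lemma forall_electric {p : Fin 6 → Fin 6 → Prop} (h12 : p 1 2) (h13 : p 1 3) (h14 : p 1 4)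
    (h15 : p 1 5) (h23 : p 2 3) (h24 : p 2 4) (h25 : p 2 5) (h34 : p 3 4) (h35 : p 3 5)
    (h45 : p 4 5) (j k : Fin 6) (hj : 0 < j) (hk : j < k) : p j k := by
  fin_cases j <;> fin_cases k <;> first | assumption | exact absurd hj (by decide) |
    exact absurd hk (by decide)

set_option maxRecDepth 10000 in
lemma isSelfdual_normalForm (u v : ℝ) : IsSelfdual (normalForm u v) := by
  apply isSelfdual_of_electric (isThreeForm_normalForm u v)
  apply forall_electric
  · exact hodge_normalForm_apply u v (l := 3) (m := 4) (n := 5) (by decide) 1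
      (by decide) (by decide) (by decide)
  · exact hodge_normalForm_apply u v (l := 2) (m := 4) (n := 5) (by decide) (-1)
      (by decide) (by decide) (by decide)
  · exact hodge_normalForm_apply u v (l := 2) (m := 3) (n := 5) (by decide) 1
      (by decide) (by decide) (by decide)
  · exact hodge_normalForm_apply u v (l := 2) (m := 3) (n := 4) (by decide) (-1)
      (by decide) (by decide) (by decide)
  · exact hodge_normalForm_apply u v (l := 1) (m := 4) (n := 5) (by decide) 1
      (by decide) (by decide) (by decide)
  · exact hodge_normalForm_apply u v (l := 1) (m := 3) (n := 5) (by decide) (-1)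
      (by decide) (by decide) (by decide)
  · exact hodge_normalForm_apply u v (l := 1) (m := 3) (n := 4) (by decide) 1
      (by decide) (by decide) (by decide)
  · exact hodge_normalForm_apply u v (l := 1) (m := 2) (n := 5) (by decide) 1
      (by decide) (by decide) (by decide)
  · exact hodge_normalForm_apply u v (l := 1) (m := 2) (n := 4) (by decide) (-1)
      (by decide) (by decide) (by decide)
  · exact hodge_normalForm_apply u v (l := 1) (m := 2) (n := 3) (by decide) 1
      (by decide) (by decide) (by decide)

/-- The value of `I₄` on the normal form. With `a`, `b`, `c` below, `M = (u+v)² a + (u-v)² b +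
(u²-v²) c`, and `I₄` follows from the integer traces of the products of `a`, `b`, `c`. -/
lemma I4_normalForm (u v : ℝ) : I4 (normalForm u v) = 384 * (u ^ 2 * v ^ 2) := by
  set sg : Fin 6 → ℤ := fun i => if i = 0 then -1 else 1 with hsg
  have heta : ∀ i, eta i = (sg i : ℝ) := by
    intro i
    simp only [eta, hsg]
    split_ifs <;> simp
  set a : Fin 6 → Fin 6 → ℤ := fun i j =>
    if i = j then (if i = 0 ∨ i = 1 ∨ i = 2 then -2 else 2) else 0 with ha
  set b : Fin 6 → Fin 6 → ℤ := fun i j =>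
    if i = j then (if i = 0 ∨ i = 3 ∨ i = 4 then -2 else 2) else 0 with hb
  set c : Fin 6 → Fin 6 → ℤ := fun i j =>
    if i = 0 ∧ j = 5 then -4 else if i = 5 ∧ j = 0 then 4 else 0 with hc
  have h11 : ∀ i j : Fin 6, ∑ k, ∑ l, basisOne i k l * (sg j * sg k * sg l * basisOne j k l) =
      a i j := by decide +kernel
  have h22 : ∀ i j : Fin 6, ∑ k, ∑ l, basisTwo i k l * (sg j * sg k * sg l * basisTwo j k l) =
      b i j := by decide +kernel
  have h12 : ∀ i j : Fin 6, ∑ k, ∑ l, (basisOne i k l * (sg j * sg k * sg l * basisTwo j k l) +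
      basisTwo i k l * (sg j * sg k * sg l * basisOne j k l)) = c i j := by decide +kernel
  have hM : ∀ i j, tensorM (normalForm u v) i j =
      (u + v) ^ 2 * (a i j : ℝ) + (u - v) ^ 2 * (b i j : ℝ) + (u + v) * (u - v) * (c i j : ℝ) := by
    intro i j
    rw [← h11, ← h22, ← h12]
    push_cast
    simp only [tensorM, raise, normalForm, heta, Finset.mul_sum, ← Finset.sum_add_distrib]
    refine Finset.sum_congr rfl fun k _ => Finset.sum_congr rfl fun l _ => ?_
    ring
  have s1 : ((∑ i, ∑ j, a i j * a j i : ℤ) : ℝ) = (24 : ℤ) := by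
    congr 1
  have s2 : ((∑ i, ∑ j, b i j * b j i : ℤ) : ℝ) = (24 : ℤ) := by
    congr 1
  have s3 : ((∑ i, ∑ j, (a i j * b j i + b i j * a j i + c i j * c j i) : ℤ) : ℝ) = (-48 : ℤ) := by
    congr 1
  have s4 : ((∑ i, ∑ j, (a i j * c j i + c i j * a j i) : ℤ) : ℝ) = (0 : ℤ) := by
    congr 1
  have s5 : ((∑ i, ∑ j, (b i j * c j i + c i j * b j i) : ℤ) : ℝ) = (0 : ℤ) := by
    congr 1
  have key : I4 (normalForm u v) =
      (u + v) ^ 4 * ((∑ i, ∑ j, a i j * a j i : ℤ) : ℝ) +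
      (u - v) ^ 4 * ((∑ i, ∑ j, b i j * b j i : ℤ) : ℝ) +
      (u + v) ^ 2 * (u - v) ^ 2 *
        ((∑ i, ∑ j, (a i j * b j i + b i j * a j i + c i j * c j i) : ℤ) : ℝ) +
      (u + v) ^ 3 * (u - v) * ((∑ i, ∑ j, (a i j * c j i + c i j * a j i) : ℤ) : ℝ) +
      (u + v) * (u - v) ^ 3 * ((∑ i, ∑ j, (b i j * c j i + c i j * b j i) : ℤ) : ℝ) := by
    push_cast
    simp only [I4, hM, Finset.mul_sum, ← Finset.sum_add_distrib]
    refine Finset.sum_congr rfl fun k _ => Finset.sum_congr rfl fun l _ => ?_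
    ring
  rw [key, s1, s2, s3, s4, s5]
  push_cast
  ring

/-! ### Lorentz transformations between normal forms -/

lemma act_diagonal (d : Fin 6 → ℝ) (T : Tensor3) (i j k : Fin 6) :
    act (Matrix.diagonal d) T i j k = d i * d j * d k * T i j k := by
  simp [act, Matrix.diagonal_apply]

lemma isLorentz_diagonal {d : Fin 6 → ℝ} (h : ∀ i, d i * d i = 1) (hd : ∏ i, d i = 1)
    (h0 : 0 < d 0) : IsLorentz (Matrix.diagonal d) := by
  refine ⟨?_, by rw [Matrix.det_diagonal, hd], by simpa using h0⟩
  simp only [etaMatrix, Matrix.diagonal_transpose, Matrix.diagonal_mul_diagonal]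
  congr 1
  funext i
  linear_combination eta i * h i

/-- The Lorentz transformation that exchanges the planes `12` and `34`. -/
def planeSwap : Matrix (Fin 6) (Fin 6) ℝ :=
  Matrix.of fun r c => if (![0, 3, 4, 1, 2, 5] : Fin 6 → Fin 6) r = c then (1 : ℝ) else 0

lemma act_planeSwap (T : Tensor3) (i j k : Fin 6) :
    act planeSwap T i j k = T ((![0, 3, 4, 1, 2, 5] : Fin 6 → Fin 6) i)
      ((![0, 3, 4, 1, 2, 5] : Fin 6 → Fin 6) j) ((![0, 3, 4, 1, 2, 5] : Fin 6 → Fin 6) k) := by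
  simp only [act, planeSwap, Matrix.of_apply]
  simp

set_option maxRecDepth 10000 in
lemma isLorentz_planeSwap : IsLorentz planeSwap := by
  refine ⟨?_, ?_, by simp [planeSwap]⟩
  · ext i j
    rw [Matrix.mul_apply]
    simp only [etaMatrix, Matrix.mul_diagonal, Matrix.transpose_apply, planeSwap, Matrix.of_apply,
      Fin.sum_univ_six, eta]
    fin_cases i <;> fin_cases j <;> simp [eta]
  · change levi ![0, 3, 4, 1, 2, 5] = 1
    rw [levi_eq_of_sign (by decide) (s := 1) (by decide)]
    simp

/-- The boost in the `05` plane with `c = cosh`, `s = sinh` of the rapidity. -/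
def boost (c s : ℝ) : Matrix (Fin 6) (Fin 6) ℝ :=
  !![c, 0, 0, 0, 0, s; 0, 1, 0, 0, 0, 0; 0, 0, 1, 0, 0, 0; 0, 0, 0, 1, 0, 0; 0, 0, 0, 0, 1, 0;
    s, 0, 0, 0, 0, c]

lemma isLorentz_boost {c s : ℝ} (h : c * c - s * s = 1) (hc : 0 < c) : IsLorentz (boost c s) := by
  refine ⟨?_, ?_, by simpa [boost] using hc⟩
  · ext i j
    rw [Matrix.mul_apply]
    simp only [etaMatrix, Matrix.mul_diagonal, Matrix.transpose_apply, boost, Fin.sum_univ_six]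
    fin_cases i <;> fin_cases j <;> simp [eta] <;> linarith
  · rw [boost]
    simp [Matrix.det_succ_row_zero, Fin.sum_univ_succ, Fin.succAbove]
    linarith

lemma basisOne_electric : ∀ j k, basisOne 0 j k =
    (![![0, 0, 0, 0, 0, 0], ![0, 0, 1, 0, 0, 0], ![0, -1, 0, 0, 0, 0],
      ![0, 0, 0, 0, 0, 0], ![0, 0, 0, 0, 0, 0], ![0, 0, 0, 0, 0, 0]] : Fin 6 → Fin 6 → ℤ) j k := by decide

lemma basisTwo_electric : ∀ j k, basisTwo 0 j k =
    (![![0, 0, 0, 0, 0, 0], ![0, 0, 0, 0, 0, 0], ![0, 0, 0, 0, 0, 0],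
      ![0, 0, 0, 0, 1, 0], ![0, 0, 0, -1, 0, 0], ![0, 0, 0, 0, 0, 0]] : Fin 6 → Fin 6 → ℤ) j k := by decide

lemma basisOne_five : ∀ j k, basisOne 5 j k =
    (![![0, 0, 0, 0, 0, 0], ![0, 0, 0, 0, 0, 0], ![0, 0, 0, 0, 0, 0],
      ![0, 0, 0, 0, -1, 0], ![0, 0, 0, 1, 0, 0], ![0, 0, 0, 0, 0, 0]] : Fin 6 → Fin 6 → ℤ) j k := by decide

lemma basisTwo_five : ∀ j k, basisTwo 5 j k =
    (![![0, 0, 0, 0, 0, 0], ![0, 0, -1, 0, 0, 0], ![0, 1, 0, 0, 0, 0],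
      ![0, 0, 0, 0, 0, 0], ![0, 0, 0, 0, 0, 0], ![0, 0, 0, 0, 0, 0]] : Fin 6 → Fin 6 → ℤ) j k := by decide

/-- Boosts in the `05` plane rescale the two null components of the normal form inversely. -/
lemma exists_boost {r : ℝ} (hr : 0 < r) :
    ∃ L, IsLorentz L ∧ ∀ u v, act L (normalForm u v) = normalForm (r * u) (r⁻¹ * v) := by
  have hL : IsLorentz (boost ((r + r⁻¹) / 2) ((r⁻¹ - r) / 2)) := by
    apply isLorentz_boost
    · have := mul_inv_cancel₀ hr.ne'
      linear_combination this
    · positivity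
  refine ⟨_, hL, fun u v => ?_⟩
  refine ((isSelfdual_normalForm u v).act hL).ext (isSelfdual_normalForm _ _) ?_
  generalize r⁻¹ = q
  generalize hc : (r + q) / 2 = c
  generalize hs : (q - r) / 2 = s
  have e1 : r = c - s := by rw [← hc, ← hs]; ring
  have e2 : q = c + s := by rw [← hc, ← hs]; ring
  rw [e1, e2]
  have r0 : ∀ t : Fin 6 → ℝ, ∑ p, boost c s 0 p * t p = c * t 0 + s * t 5 := by
    intro t; simp [boost, Fin.sum_univ_six]
  have r5 : ∀ t : Fin 6 → ℝ, ∑ p, boost c s 5 p * t p = s * t 0 + c * t 5 := by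
    intro t; simp [boost, Fin.sum_univ_six]
  have r1 : ∀ t : Fin 6 → ℝ, ∑ p, boost c s 1 p * t p = t 1 := by
    intro t; simp [boost, Fin.sum_univ_six]
  have r2 : ∀ t : Fin 6 → ℝ, ∑ p, boost c s 2 p * t p = t 2 := by
    intro t; simp [boost, Fin.sum_univ_six]
  have r3 : ∀ t : Fin 6 → ℝ, ∑ p, boost c s 3 p * t p = t 3 := by
    intro t; simp [boost, Fin.sum_univ_six]
  have r4 : ∀ t : Fin 6 → ℝ, ∑ p, boost c s 4 p * t p = t 4 := by
    intro t; simp [boost, Fin.sum_univ_six]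
  apply forall_electric <;>
    · simp only [act_eq, r0, r1, r2, r3, r4, r5]
      simp [normalForm, basisOne_electric, basisTwo_electric, basisOne_five, basisTwo_five]
      try ring

lemma act_planeSwap_normalForm (u v : ℝ) :
    act planeSwap (normalForm u v) = normalForm u (-v) := by
  set σ : Fin 6 → Fin 6 := ![0, 3, 4, 1, 2, 5] with hσ
  have h1 : ∀ i j k, basisOne (σ i) (σ j) (σ k) = basisTwo i j k := by decide +kernel
  have h2 : ∀ i j k, basisTwo (σ i) (σ j) (σ k) = basisOne i j k := by decide +kernel
  funext i j k
  rw [act_planeSwap, ← hσ]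
  simp only [normalForm, h1, h2]
  ring

/-- Diagonal Lorentz transformations act on the two basis forms by signs. -/
lemma act_diagonal_normalForm (d : Fin 6 → ℤ) (a b : ℤ)
    (h1 : ∀ i j k, d i * d j * d k * basisOne i j k = a * basisOne i j k)
    (h2 : ∀ i j k, d i * d j * d k * basisTwo i j k = b * basisTwo i j k) (u v : ℝ) :
    act (Matrix.diagonal fun i => (d i : ℝ)) (normalForm u v) =
      normalForm ((a * (u + v) + b * (u - v)) / 2) ((a * (u + v) - b * (u - v)) / 2) := by
  funext i j k
  have e1 := congrArg (Int.cast : ℤ → ℝ) (h1 i j k)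
  have e2 := congrArg (Int.cast : ℤ → ℝ) (h2 i j k)
  push_cast at e1 e2
  rw [act_diagonal]
  simp only [normalForm]
  linear_combination (u + v) * e1 + (u - v) * e2

lemma isLorentz_diagonal_intCast {d : Fin 6 → ℤ} (h : ∀ i, d i * d i = 1) (hd : ∏ i, d i = 1)
    (h0 : 0 < d 0) : IsLorentz (Matrix.diagonal fun i => (d i : ℝ)) :=
  isLorentz_diagonal (fun i => by exact_mod_cast h i) (by exact_mod_cast hd) (by exact_mod_cast h0)

/-- A reflection of the directions `1` and `5` exchanges the two null components. -/
lemma exists_null_swap :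
    ∃ L, IsLorentz L ∧ ∀ u v, act L (normalForm u v) = normalForm (-v) (-u) := by
  refine ⟨_, isLorentz_diagonal_intCast (d := ![1, -1, 1, 1, 1, -1]) (by decide) (by decide)
    (by decide), fun u v => ?_⟩
  rw [act_diagonal_normalForm _ (-1) 1 (by decide +kernel) (by decide +kernel)]
  congr 1 <;> push_cast <;> ring

/-- Averaging over the rotations by `π` in the planes `12` and `34`, which fix all normal forms,
projects the selfdual 3-forms onto the normal forms. -/
lemma exists_average :
    ∃ L K, IsLorentz L ∧ IsLorentz K ∧ (∀ u v, act L (normalForm u v) = normalForm u v) ∧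
      (∀ u v, act K (normalForm u v) = normalForm u v) ∧
      ∀ W, IsSelfdual W → ∃ u v, W + act L W + act K W + act K (act L W) = normalForm u v := by
  have hL := isLorentz_diagonal_intCast (d := ![1, -1, -1, 1, 1, 1]) (by decide) (by decide)
    (by decide)
  have hK := isLorentz_diagonal_intCast (d := ![1, 1, 1, -1, -1, 1]) (by decide) (by decide)
    (by decide)
  refine ⟨_, _, hL, hK, fun u v => ?_, fun u v => ?_, fun W hW =>
    ⟨2 * (W 0 1 2 + W 0 3 4), 2 * (W 0 1 2 - W 0 3 4), ?_⟩⟩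
  · rw [act_diagonal_normalForm _ 1 1 (by decide +kernel) (by decide +kernel)]
    congr 1 <;> push_cast <;> ring
  · rw [act_diagonal_normalForm _ 1 1 (by decide +kernel) (by decide +kernel)]
    congr 1 <;> push_cast <;> ring
  · refine IsSelfdual.ext (selfdualForms.add_mem (selfdualForms.add_mem
      (selfdualForms.add_mem hW (hW.act hL)) (hW.act hK)) ((hW.act hL).act hK))
      (isSelfdual_normalForm _ _) ?_
    apply forall_electric <;>
      · simp [act_diagonal, normalForm, basisOne_electric, basisTwo_electric]
        try ring

/-- The Lorentz transformation given by a rotation of the spatial coordinates. -/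
def spatial (O : Matrix (Fin 5) (Fin 5) ℝ) : Matrix (Fin 6) (Fin 6) ℝ :=
  Matrix.of (Fin.cons (Fin.cons 1 0) fun a => Fin.cons 0 (O a))

lemma isLorentz_spatial {O : Matrix (Fin 5) (Fin 5) ℝ} (h : O.transpose * O = 1)
    (hdet : O.det = 1) : IsLorentz (spatial O) := by
  refine ⟨?_, ?_, by simp [spatial]⟩
  · ext i j
    rw [Matrix.mul_apply, Fin.sum_univ_succ]
    simp only [etaMatrix, Matrix.mul_diagonal, Matrix.transpose_apply, spatial, Matrix.of_apply]
    have hO : ∀ a b, ∑ c, O c a * O c b = if a = b then 1 else 0 := by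
      intro a b
      have := congrFun (congrFun h a) b
      simpa [Matrix.mul_apply, Matrix.one_apply] using this
    refine Fin.cases ?_ (fun a => ?_) i <;> refine Fin.cases ?_ (fun b => ?_) j
    · simp [eta]
    · simp [eta, (Fin.succ_ne_zero _).symm]
    · simp [eta]
    · simp [eta, Matrix.diagonal_apply, hO]
  · rw [Matrix.det_succ_row_zero, Fin.sum_univ_succ]
    have : (spatial O).submatrix Fin.succ (Fin.succAbove 0) = O := by
      ext a b
      simp [spatial]
    rw [this, hdet]
    simp [spatial]

/-- Every selfdual 3-form is Lorentz equivalent to a normal form. -/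
lemma exists_act_normalForm {Y : Tensor3} (hY : IsSelfdual Y) :
    ∃ L, IsLorentz L ∧ ∃ u v, Y = act L (normalForm u v) := by
  obtain ⟨O, hO, hdet, x, y, hB⟩ := exists_rotation_skewBlock
    (Matrix.of fun a b => Y 0 a.succ b.succ) (fun a b => hY.1.2 0 a.succ b.succ)
  have hL := isLorentz_spatial hO hdet
  refine ⟨_, hL, (x + y) / 2, (x - y) / 2, hY.ext ((isSelfdual_normalForm _ _).act hL) ?_⟩
  have hN : ∀ c d : Fin 5, normalForm ((x + y) / 2) ((x - y) / 2) 0 c.succ d.succ =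
      skewBlock x y c d := by
    intro c d
    simp only [normalForm, basisOne_electric, basisTwo_electric]
    fin_cases c <;> fin_cases d <;> simp [skewBlock] <;> ring
  intro j k hj hk
  obtain ⟨a, rfl⟩ := Fin.exists_succ_eq.2 hj.ne'
  obtain ⟨b, rfl⟩ := Fin.exists_succ_eq.2 (hj.trans hk).ne'
  have h := congrFun (congrFun hB a) b
  rw [Matrix.of_apply] at h
  rw [h, act_eq]
  simp only [Fin.sum_univ_succ (n := 5)]
  simp only [spatial, Matrix.of_apply, Fin.cons_succ, Fin.cons_zero, hN, Matrix.mul_apply,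
    Matrix.transpose_apply, Finset.mul_sum, Finset.sum_mul, Pi.zero_apply, one_mul, zero_mul,
    zero_add, Finset.sum_const_zero, add_zero]
  rw [Finset.sum_comm]
  refine Finset.sum_congr rfl fun c _ => Finset.sum_congr rfl fun d _ => ?_
  ring

/-! ### Classification of the covariant antiselfdual polynomials -/

lemma exists_polynomial_eval_sq {P : Polynomial ℝ} (heven : ∀ t, P.eval (-t) = P.eval t)
    (h0 : P.eval 0 = 0) : ∃ f : Polynomial ℝ, ∀ t, P.eval t = t ^ 2 * f.eval (t ^ 2) := by
  have hc : P.comp (Polynomial.C (-1) * Polynomial.X) = P := Polynomial.funext fun t => by simp [heven]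
  have hodd : ∀ n, ¬ 2 ∣ n → P.coeff n = 0 := by
    intro n hn
    have := congrArg (fun p => p.coeff n) hc
    simp only [Polynomial.comp_C_mul_X_coeff] at this
    rw [(Nat.odd_iff.2 (Nat.two_dvd_ne_zero.1 hn)).neg_one_pow] at this
    linarith
  have hP : P = Polynomial.expand ℝ 2 (Polynomial.contract 2 P) := by
    ext n
    rw [Polynomial.coeff_expand (by norm_num), Polynomial.coeff_contract (by norm_num)]
    split_ifs with h
    · rw [Nat.div_mul_cancel h]
    · exact hodd n h
  have hX : Polynomial.X ∣ Polynomial.contract 2 P := by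
    rw [Polynomial.X_dvd_iff, Polynomial.coeff_contract (by norm_num), zero_mul,
      Polynomial.coeff_zero_eq_eval_zero, h0]
  obtain ⟨f, hf⟩ := hX
  refine ⟨f, fun t => ?_⟩
  conv_lhs => rw [hP, hf, Polynomial.expand_eval]
  simp

lemma exists_derivative_eq (h : Polynomial ℝ) : ∃ F : Polynomial ℝ, F.derivative = h := by
  induction h using Polynomial.induction_on' with
  | add p q hp hq =>
    obtain ⟨P, rfl⟩ := hp
    obtain ⟨Q, rfl⟩ := hq
    exact ⟨P + Q, Polynomial.derivative_add⟩
  | monomial n a =>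
    refine ⟨Polynomial.monomial (n + 1) (a / (n + 1)), ?_⟩
    rw [Polynomial.derivative_monomial]
    congr 1
    push_cast
    field_simp

/-- A covariant bilinear expression in selfdual forms that vanishes on the normal forms vanishes
identically. -/
lemma eq_zero_of_normalForm (φ : Tensor3 → Tensor3 → ℝ)
    (hadd : ∀ Y V W, φ Y (V + W) = φ Y V + φ Y W)
    (hcov : ∀ L, IsLorentz L → ∀ Y W, IsSelfdual Y → φ (act L Y) (act L W) = φ Y W)
    (h0 : ∀ u v a b, φ (normalForm u v) (normalForm a b) = 0)
    {Y W : Tensor3} (hY : IsSelfdual Y) (hW : IsSelfdual W) : φ Y W = 0 := by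
  obtain ⟨M, hM, u, v, rfl⟩ := exists_act_normalForm hY
  obtain ⟨V, hV, rfl⟩ := hM.exists_selfdual_act_eq hW
  have hN := isSelfdual_normalForm u v
  rw [hcov M hM _ _ hN]
  obtain ⟨L, K, hL, hK, hLN, hKN, hav⟩ := exists_average
  obtain ⟨a, b, hab⟩ := hav V hV
  have e1 : ∀ W, φ (normalForm u v) (act L W) = φ (normalForm u v) W := by
    intro W
    conv_lhs => rw [← hLN u v]
    exact hcov L hL _ _ hN
  have e2 : ∀ W, φ (normalForm u v) (act K W) = φ (normalForm u v) W := by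
    intro W
    conv_lhs => rw [← hKN u v]
    exact hcov K hK _ _ hN
  have := h0 u v a b
  rw [← hab, hadd, hadd, hadd, e2, e2, e1] at this
  linarith

lemma normalForm_add_smul (u v a b t : ℝ) :
    normalForm u v + t • normalForm a b = normalForm (u + t * a) (v + t * b) := by
  funext i j k
  simp only [normalForm, Pi.add_apply, Pi.smul_apply, smul_eq_mul]
  ring

lemma smul_normalForm (t a b : ℝ) : t • normalForm a b = normalForm (t * a) (t * b) := by
  funext i j k
  simp only [normalForm, Pi.smul_apply, smul_eq_mul]
  ring

lemma IsCovariantPolynomial.pair_act {g : Tensor3 → Tensor3} (hg : IsCovariantPolynomial g)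
    {L : Matrix (Fin 6) (Fin 6) ℝ} (hL : IsLorentz L) {Y : Tensor3} (hY : IsSelfdual Y)
    (W : Tensor3) : pair (g (act L Y)) (act L W) = pair (g Y) W := by
  rw [hg.covariant L hL Y hY, Chiral6d.pair_act hL.1]

lemma IsCovariantPolynomial.exists_polynomial_line {g : Tensor3 → Tensor3}
    (hg : IsCovariantPolynomial g) {Y V : Tensor3} (hY : IsSelfdual Y) (hV : IsSelfdual V)
    (W : Tensor3) : ∃ P : Polynomial ℝ, ∀ t : ℝ, pair (g (Y + t • V)) W = P.eval t := by
  obtain ⟨P, hP⟩ := hg.polynomial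
  refine ⟨∑ i, ∑ j, ∑ k, Polynomial.C (eta i * eta j * eta k * W i j k) *
    MvPolynomial.aeval (fun s : Fin 6 × Fin 6 × Fin 6 =>
      Polynomial.C (Y s.1 s.2.1 s.2.2) + Polynomial.X * Polynomial.C (V s.1 s.2.1 s.2.2))
      (P i j k), fun t => ?_⟩
  have h : ∀ i j k, g (Y + t • V) i j k = (MvPolynomial.aeval (fun s : Fin 6 × Fin 6 × Fin 6 =>
      Polynomial.C (Y s.1 s.2.1 s.2.2) + Polynomial.X * Polynomial.C (V s.1 s.2.1 s.2.2))
      (P i j k)).eval t := by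
    intro i j k
    rw [hP _ (selfdualForms.add_mem hY (selfdualForms.smul_mem t hV)), ← Polynomial.coe_aeval_eq_eval,
      MvPolynomial.comp_aeval_apply, ← MvPolynomial.coe_aeval_eq_eval]
    simp [mul_comm t]
  simp only [pair, raise, h, Polynomial.eval_finsetSum, Polynomial.eval_mul, Polynomial.eval_C]
  refine Finset.sum_congr rfl fun i _ => Finset.sum_congr rfl fun j _ =>
    Finset.sum_congr rfl fun k _ => ?_
  ring

/-- On normal forms a covariant polynomial is a function of the invariant `u² v²` times the
differential of `u² v² / 2`. The boosts fix the dependence on `u v` up to the polynomial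
`P(t) = p(1, t)`, which is even by the exchange of two planes and vanishes at `0` because
`u p(u, v) = P(u v)`. -/
lemma IsCovariantPolynomial.exists_pair_normalForm {g : Tensor3 → Tensor3}
    (hg : IsCovariantPolynomial g) : ∃ f : Polynomial ℝ, ∀ u v a b,
      pair (g (normalForm u v)) (normalForm a b) =
        f.eval (u ^ 2 * v ^ 2) * (u * v ^ 2 * a + u ^ 2 * v * b) := by
  set p : ℝ → ℝ → ℝ := fun u v => pair (g (normalForm u v)) (normalForm 1 0) with hp
  obtain ⟨P, hP⟩ := hg.exists_polynomial_line (isSelfdual_normalForm 1 0)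
    (isSelfdual_normalForm 0 1) (normalForm 1 0)
  have hP' : ∀ t, p 1 t = P.eval t := by
    intro t
    rw [← hP, normalForm_add_smul]
    simp [hp]
  have hpos : ∀ u v, 0 < u → u * p u v = P.eval (u * v) := by
    intro u v hu
    obtain ⟨L, hL, hLN⟩ := exists_boost hu
    have h := hg.pair_act hL (isSelfdual_normalForm 1 (u * v)) (normalForm 1 0)
    rw [hLN, hLN, inv_mul_cancel_left₀ hu.ne', mul_one, mul_zero] at h
    rw [← hP']
    simp only [hp]
    rw [← h, ← pair_smul_right, smul_normalForm, mul_one, mul_zero]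
  have hline : ∀ v, ∃ Q : Polynomial ℝ, (∀ t, p t v = Q.eval t) ∧
      ∀ t, t * Q.eval t = P.eval (t * v) := by
    intro v
    obtain ⟨Q, hQ⟩ := hg.exists_polynomial_line (isSelfdual_normalForm 0 v)
      (isSelfdual_normalForm 1 0) (normalForm 1 0)
    have hQ' : ∀ t, p t v = Q.eval t := by
      intro t
      rw [← hQ, normalForm_add_smul]
      simp [hp]
    have heq : Polynomial.X * Q = P.comp (Polynomial.X * Polynomial.C v) := by
      apply Polynomial.eq_of_infinite_eval_eq
      refine Set.Infinite.mono ?_ (Set.Ioi_infinite (0 : ℝ))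
      intro t ht
      simp only [Set.mem_ofPred_eq, Polynomial.eval_mul, Polynomial.eval_X, Polynomial.eval_comp,
        Polynomial.eval_C]
      rw [← hQ', hpos t v ht]
    refine ⟨Q, hQ', fun t => ?_⟩
    have := congrArg (Polynomial.eval t) heq
    simpa only [Polynomial.eval_mul, Polynomial.eval_X, Polynomial.eval_comp,
      Polynomial.eval_C] using this
  have heven : ∀ t, P.eval (-t) = P.eval t := by
    intro t
    rw [← hP', ← hP']
    simp only [hp]
    rw [← hg.pair_act isLorentz_planeSwap (isSelfdual_normalForm 1 t), act_planeSwap_normalForm,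
      act_planeSwap_normalForm, neg_zero]
  have hzero : P.eval 0 = 0 := by
    obtain ⟨Q, _, hQ⟩ := hline 0
    simpa using (hQ 0).symm
  obtain ⟨f, hf⟩ := exists_polynomial_eval_sq heven hzero
  have hpf : ∀ u v, p u v = f.eval (u ^ 2 * v ^ 2) * (u * v ^ 2) := by
    intro u v
    obtain ⟨Q, hQ1, hQ2⟩ := hline v
    have : Q = f.comp (Polynomial.X ^ 2 * Polynomial.C (v ^ 2)) *
        (Polynomial.X * Polynomial.C (v ^ 2)) := by
      apply mul_left_cancel₀ (Polynomial.X_ne_zero (R := ℝ))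
      apply Polynomial.funext
      intro t
      rw [Polynomial.eval_mul, Polynomial.eval_X, hQ2, hf]
      simp
      ring_nf
    rw [hQ1, this]
    simp
  refine ⟨f, fun u v a b => ?_⟩
  have hq : pair (g (normalForm u v)) (normalForm 0 1) = f.eval (u ^ 2 * v ^ 2) * (u ^ 2 * v) := by
    obtain ⟨L, hL, hLN⟩ := exists_null_swap
    rw [← hg.pair_act hL (isSelfdual_normalForm u v), hLN, hLN]
    have h1 : normalForm (-1) (-0) = (-1 : ℝ) • normalForm 1 0 := by
      rw [smul_normalForm]
      simp
    have h2 := hpf (-v) (-u)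
    rw [h1, pair_smul_right]
    simp only [hp] at h2
    rw [h2]
    ring_nf
  have hab : normalForm a b = a • normalForm 1 0 + b • normalForm 0 1 := by
    rw [smul_normalForm, normalForm_add_smul]
    simp
  have h2 := hpf u v
  simp only [hp] at h2
  rw [hab, pair_add_right, pair_smul_right, pair_smul_right, h2, hq]
  ring

lemma fderiv_I4_normalForm (u v a b : ℝ) :
    fderiv ℝ I4 (normalForm u v) (normalForm a b) = 768 * (u * v ^ 2 * a + u ^ 2 * v * b) := by
  have h1 : HasDerivAt (fun t : ℝ => normalForm u v + t • normalForm a b) (normalForm a b) 0 := by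
    simpa using ((hasDerivAt_id (0 : ℝ)).smul_const (normalForm a b)).const_add (normalForm u v)
  have h2 : HasFDerivAt I4 (fderiv ℝ I4 (normalForm u v)) (normalForm u v + (0 : ℝ) • normalForm a b) := by
    rw [zero_smul, add_zero]
    exact (contDiff_I4.differentiable (by simp) _).hasFDerivAt
  have h3 := h2.comp_hasDerivAt (0 : ℝ) h1
  have h4 : I4 ∘ (fun t : ℝ => normalForm u v + t • normalForm a b) =
      fun t => 384 * ((u + t * a) ^ 2 * (v + t * b) ^ 2) := by
    funext t
    simp only [Function.comp_apply, normalForm_add_smul, I4_normalForm]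
  rw [h4] at h3
  have h5 : HasDerivAt (fun t : ℝ => 384 * ((u + t * a) ^ 2 * (v + t * b) ^ 2))
      (768 * (u * v ^ 2 * a + u ^ 2 * v * b)) 0 := by
    have ha : HasDerivAt (fun t : ℝ => u + t * a) a 0 := by
      simpa using ((hasDerivAt_id (0 : ℝ)).mul_const a).const_add u
    have hb : HasDerivAt (fun t : ℝ => v + t * b) b 0 := by
      simpa using ((hasDerivAt_id (0 : ℝ)).mul_const b).const_add v
    refine (((ha.pow 2).mul (hb.pow 2)).const_mul 384).congr_deriv ?_
    simp
    ring
  exact h3.unique h5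

/-- The antiselfdual part of a covariant polynomial is that of `-∂𝓕(I₄)/∂Y`. -/
lemma IsCovariantPolynomial.exists_tensorX {g : Tensor3 → Tensor3}
    (hg : IsCovariantPolynomial g) : ∃ F : Polynomial ℝ, ∀ Y, IsSelfdual Y →
      g Y - hodge (g Y) = hodge (tensorX F Y) - tensorX F Y := by
  obtain ⟨f, hf⟩ := hg.exists_pair_normalForm
  -- `I₄ = 384 u² v²` on normal forms, so `𝓕'(384 s) d(384 s) = - f(s) ds / 2`.
  obtain ⟨F, hF⟩ := exists_derivative_eq
    (Polynomial.C (-1 / 768) * f.comp (Polynomial.C (1 / 384) * Polynomial.X))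
  refine ⟨F, fun Y hY => ?_⟩
  have key : ∀ W, IsSelfdual W → pair (g Y + tensorX F Y) W = 0 := by
    intro W hW
    have := eq_zero_of_normalForm
      (fun Y W => pair (g Y) W + F.derivative.eval (I4 Y) * fderiv ℝ I4 Y W)
      (fun Y V W => by simp only [pair_add_right, map_add]; ring)
      (fun L hL Y W hY => by
        simp only [hg.pair_act hL hY, I4_act hL.1, fderiv_I4_act hL.1])
      (fun u v a b => by
        simp only [hf, fderiv_I4_normalForm, I4_normalForm, hF, Polynomial.eval_mul,
          Polynomial.eval_C, Polynomial.eval_comp, Polynomial.eval_X]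
        ring_nf) hY hW
    rw [pair_add_left, pair_tensorX F Y hW.1]
    exact this
  have hZ : IsThreeForm (g Y + tensorX F Y) :=
    (hg.isThreeForm Y hY).add (isThreeForm_tensorX F Y)
  have h0 : (g Y + tensorX F Y) - hodge (g Y + tensorX F Y) = 0 := by
    apply eq_zero_of_pair_raise
    set T := raise ((g Y + tensorX F Y) - hodge (g Y + tensorX F Y)) with hT
    have hT3 : IsThreeForm T := (hZ.sub (isThreeForm_hodge _)).raise
    have := key _ (isSelfdual_add_hodge hT3)
    rw [pair_comm, pair_sub_left, pair_hodge, sub_neg_eq_add, ← pair_add_right, this]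
  rw [hodge_add] at h0
  rw [← sub_eq_zero, ← h0]
  abel

/-! ### Exterior derivatives, contractions and the Bianchi identity -/

lemma isThreeForm_extDer (D : Fin 6 → TwoForm) : IsThreeForm (extDer D) := by
  have h : ∀ i j k, (D i : Fin 6 → Fin 6 → ℝ) k j = -(D i : Fin 6 → Fin 6 → ℝ) j k :=
    fun i j k => (D i).2 j k
  refine ⟨fun i j k => ?_, fun i j k => ?_⟩
  · simp only [extDer, h i j k, h j k i, h k i j]; ring
  · simp only [extDer, h i j k, h j k i, h k i j]; ring

/-- The exterior derivative as a linear function of the first partial derivatives. -/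
def extDerLin : (Fin 6 → TwoForm) →ₗ[ℝ] Tensor3 where
  toFun := extDer
  map_add' D D' := by
    funext i j k
    simp only [extDer, Pi.add_apply, Submodule.coe_add]
    ring
  map_smul' c D := by
    funext i j k
    simp only [extDer, Pi.smul_apply, Submodule.coe_smul, smul_eq_mul, RingHom.id_apply]
    ring

lemma extDer_add (D D' : Fin 6 → TwoForm) : extDer (D + D') = extDer D + extDer D' :=
  extDerLin.map_add D D'

lemma extDer_smul (c : ℝ) (D : Fin 6 → TwoForm) : extDer (c • D) = c • extDer D :=
  extDerLin.map_smul c D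

/-- The contraction `v^i T_{ijk}`. -/
def interior (v : Fin 6 → ℝ) (T : Tensor3) (j k : Fin 6) : ℝ := ∑ i, eta i * v i * T i j k

/-- The divergence of a 3-form `K` with partial derivatives `D i = ∂_i K`, tested against a
constant 2-form `α`: it equals `3 ∂_i K^{ijk} α_{jk}`. In this form it appears in the
Euler-Lagrange equations, `extDer (Pi.single i α)` being the variation of the field strength under
a variation `α` of the `i`-th partial derivative of the potential. -/
def divPair (D : Fin 6 → Tensor3) (α : TwoForm) : ℝ :=
  ∑ i, pair (D i) (extDer (Pi.single i α))

lemma divPair_add (D D' : Fin 6 → Tensor3) (α : TwoForm) :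
    divPair (D + D') α = divPair D α + divPair D' α := by
  simp only [divPair, Pi.add_apply, pair_add_left, Finset.sum_add_distrib]

lemma divPair_sub (D D' : Fin 6 → Tensor3) (α : TwoForm) :
    divPair (D - D') α = divPair D α - divPair D' α := by
  simp only [divPair, Pi.sub_apply, pair_sub_left, Finset.sum_sub_distrib]

lemma divPair_smul (c : ℝ) (D : Fin 6 → Tensor3) (α : TwoForm) :
    divPair (c • D) α = c * divPair D α := by
  simp only [divPair, Pi.smul_apply, pair_smul_left, Finset.mul_sum]

lemma pair_extDer {T : Tensor3} (hT : IsThreeForm T) (D : Fin 6 → TwoForm) :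
    pair T (extDer D) = 3 * ∑ i, ∑ j, ∑ k, raise T i j k * (D i : Fin 6 → Fin 6 → ℝ) j k := by
  have hc := hT.raise.cycle
  have e : ∀ i j k, raise T i j k * extDer D i j k =
      raise T i j k * (D i : Fin 6 → Fin 6 → ℝ) j k
      + raise T j k i * (D j : Fin 6 → Fin 6 → ℝ) k i
      + raise T k i j * (D k : Fin 6 → Fin 6 → ℝ) i j := by
    intro i j k
    rw [hc i j k, ← hc k i j, extDer]
    ring
  simp only [pair, e, Finset.sum_add_distrib]
  have e1 : ∀ G : Tensor3, ∑ i, ∑ j, ∑ k, G j k i = ∑ i, ∑ j, ∑ k, G i j k := by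
    intro G
    rw [Finset.sum_comm]
    refine Finset.sum_congr rfl fun i _ => ?_
    rw [Finset.sum_comm]
  have e2 := e1 fun i j k => raise T i j k * (D i : Fin 6 → Fin 6 → ℝ) j k
  have e3 := e1 fun i j k => raise T j k i * (D j : Fin 6 → Fin 6 → ℝ) k i
  rw [e3, e2]
  ring

lemma sum_smul_single (v : Fin 6 → ℝ) (α : TwoForm) :
    ∑ i, v i • (Pi.single i α : Fin 6 → TwoForm) = fun i => v i • α := by
  funext j
  simp [Finset.sum_apply, Pi.single_apply]

lemma divPair_smul_const {T : Tensor3} (hT : IsThreeForm T) (v : Fin 6 → ℝ) (α : TwoForm) :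
    divPair (fun i => v i • T) α =
      3 * ∑ j, ∑ k, eta j * eta k * interior v T j k * (α : Fin 6 → Fin 6 → ℝ) j k := by
  have h : divPair (fun i => v i • T) α = pair T (extDer fun i => v i • α) := by
    rw [← sum_smul_single]
    change _ = pairLin T (extDerLin _)
    simp only [map_sum, map_smul, divPair, pair_smul_left]
    rfl
  rw [h, pair_extDer hT]
  congr 1
  rw [Finset.sum_comm]
  refine Finset.sum_congr rfl fun j _ => ?_
  rw [Finset.sum_comm]
  refine Finset.sum_congr rfl fun k _ => ?_
  simp only [interior, Finset.mul_sum, Finset.sum_mul, raise, Submodule.coe_smul, Pi.smul_apply,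
    smul_eq_mul]
  refine Finset.sum_congr rfl fun i _ => ?_
  ring

lemma forall_divPair_smul_eq_zero_iff {T : Tensor3} (hT : IsThreeForm T) (v : Fin 6 → ℝ) :
    (∀ α, divPair (fun i => v i • T) α = 0) ↔ ∀ j k, interior v T j k = 0 := by
  constructor
  · intro h
    have hanti : ∀ j k, interior v T k j = -interior v T j k := by
      intro j k
      simp only [interior, ← Finset.sum_neg_distrib]
      refine Finset.sum_congr rfl fun i _ => ?_
      rw [hT.2 i j k]
      ring
    have h1 := h ⟨fun j k => eta j * eta k * interior v T j k, fun j k => by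
      simp only [hanti j k]
      ring⟩
    rw [divPair_smul_const hT] at h1
    have h2 : ∑ j, ∑ k, (eta j * eta k * interior v T j k) ^ 2 = 0 := by
      simp only [pow_two]
      linarith
    intro j k
    rw [Finset.sum_eq_zero_iff_of_nonneg fun j _ => Finset.sum_nonneg fun k _ => sq_nonneg _] at h2
    have h3 := h2 j (Finset.mem_univ j)
    rw [Finset.sum_eq_zero_iff_of_nonneg fun k _ => sq_nonneg _] at h3
    have h4 := pow_eq_zero_iff (two_ne_zero) |>.1 (h3 k (Finset.mem_univ k))
    linear_combination (eta j * eta k) * h4 - (interior v T j k * eta k * eta k) * eta_mul_self j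
      - interior v T j k * eta_mul_self k
  · intro h α
    rw [divPair_smul_const hT]
    simp [h]

/-- Up to sign, the components of the contraction of `v` with `⋆T` are those of `v ∧ T`. -/
lemma interior_hodge_apply {T : Tensor3} (hT : IsThreeForm T) (v : Fin 6 → ℝ)
    {a b c d m n : Fin 6} (hf : Function.Injective ![a, b, c, d, m, n]) :
    interior v (hodge T) m n = -levi ![a, b, c, d, m, n] * (eta a * eta b * eta c * eta d) *
      wedgeOne v T a b c d := by
  have hs : interior v (hodge T) m n = ∑ x, eta (![a, b, c, d, m, n] x) * v (![a, b, c, d, m, n] x) *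
      hodge T (![a, b, c, d, m, n] x) m n := by
    rw [interior, ← Equiv.sum_comp (Equiv.ofBijective _ (Finite.injective_iff_bijective.1 hf))]
    rfl
  rw [hs, Fin.sum_univ_six]
  change eta a * v a * hodge T a m n + eta b * v b * hodge T b m n + eta c * v c * hodge T c m n
    + eta d * v d * hodge T d m n + eta m * v m * hodge T m m n + eta n * v n * hodge T n m n = _
  rw [(isThreeForm_hodge T).eq_zero_left, (isThreeForm_hodge T).eq_zero_outer]
  have hi := injective_tuple.1 hf
  have ha : hodge T a m n = -levi ![a, b, c, d, m, n] * (eta b * eta c * eta d * T b c d) := by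
    have e := hodge_apply hT (f := ![a, m, n, b, c, d]) (injective_tuple.2 (by grind))
    rw [show levi ![a, m, n, b, c, d] = levi ![a, b, c, d, m, n] by
      rw [levi_swap_third, levi_swap_fourth, levi_swap_fifth, levi_swap_second, levi_swap_third,
        levi_swap_fourth]; ring] at e
    exact e
  have hb : hodge T b m n = levi ![a, b, c, d, m, n] * (eta a * eta c * eta d * T a c d) := by
    have e := hodge_apply hT (f := ![b, m, n, a, c, d]) (injective_tuple.2 (by grind))
    rw [show levi ![b, m, n, a, c, d] = -levi ![a, b, c, d, m, n] by
      rw [levi_swap_third, levi_swap_fourth, levi_swap_fifth, levi_swap_second, levi_swap_third,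
        levi_swap_fourth, levi_swap_first]; ring] at e
    rw [neg_neg] at e
    exact e
  have hc : hodge T c m n = -levi ![a, b, c, d, m, n] * (eta a * eta b * eta d * T a b d) := by
    have e := hodge_apply hT (f := ![c, m, n, a, b, d]) (injective_tuple.2 (by grind))
    rw [show levi ![c, m, n, a, b, d] = levi ![a, b, c, d, m, n] by
      rw [levi_swap_third, levi_swap_fourth, levi_swap_fifth, levi_swap_second, levi_swap_third,
        levi_swap_fourth, levi_swap_first, levi_swap_second]; ring] at e
    exact e
  have hd : hodge T d m n = levi ![a, b, c, d, m, n] * (eta a * eta b * eta c * T a b c) := by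
    have e := hodge_apply hT (f := ![d, m, n, a, b, c]) (injective_tuple.2 (by grind))
    rw [show levi ![d, m, n, a, b, c] = -levi ![a, b, c, d, m, n] by
      rw [levi_swap_third, levi_swap_fourth, levi_swap_fifth, levi_swap_second, levi_swap_third,
        levi_swap_fourth, levi_swap_first, levi_swap_second, levi_swap_third]; ring] at e
    rw [neg_neg] at e
    exact e
  rw [ha, hb, hc, hd, wedgeOne]
  ring

lemma exists_complement_four {a b c d : Fin 6} (hab : a ≠ b) (hac : a ≠ c) (had : a ≠ d)
    (hbc : b ≠ c) (hbd : b ≠ d) (hcd : c ≠ d) :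
    ∃ m n, Function.Injective ![a, b, c, d, m, n] := by
  obtain ⟨l, m, n, h⟩ := exists_complement_three a b c hab hac hbc
  obtain ⟨x, hx⟩ := Finite.injective_iff_surjective.1 h d
  have hi := injective_tuple.1 h
  fin_cases x
  · exact absurd hx had
  · exact absurd hx hbd
  · exact absurd hx hcd
  · exact ⟨m, n, by rw [← show l = d from hx]; exact h⟩
  · exact ⟨l, n, by rw [← show m = d from hx]; exact injective_tuple.2 (by grind)⟩
  · exact ⟨l, m, by rw [← show n = d from hx]; exact injective_tuple.2 (by grind)⟩

lemma exists_complement_two {m n : Fin 6} (h : m ≠ n) :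
    ∃ a b c d, Function.Injective ![a, b, c, d, m, n] := by
  obtain ⟨a, ham, han⟩ : ∃ a, a ≠ m ∧ a ≠ n := by
    revert m n
    decide
  obtain ⟨b, c, d, hf⟩ := exists_complement_three m n a h ham.symm han.symm
  have hi := injective_tuple.1 hf
  exact ⟨a, b, c, d, injective_tuple.2 (by grind)⟩

/-- The contraction of `v` with `⋆T` vanishes exactly if `v ∧ T` does. -/
lemma interior_hodge_eq_zero_iff {T : Tensor3} (hT : IsThreeForm T) (v : Fin 6 → ℝ) :
    (∀ j k, interior v (hodge T) j k = 0) ↔ wedgeOne v T = 0 := by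
  constructor
  · intro h
    funext a b c d
    change wedgeOne v T a b c d = 0
    by_cases hdist : a ≠ b ∧ a ≠ c ∧ a ≠ d ∧ b ≠ c ∧ b ≠ d ∧ c ≠ d
    · obtain ⟨hab, hac, had, hbc, hbd, hcd⟩ := hdist
      obtain ⟨m, n, hf⟩ := exists_complement_four hab hac had hbc hbd hcd
      have e := interior_hodge_apply hT v hf
      rw [h m n] at e
      have he : ∀ i, eta i ≠ 0 := fun i h0 => by
        have := eta_mul_self i
        rw [h0, mul_zero] at this
        exact zero_ne_one this
      have hl : levi ![a, b, c, d, m, n] ≠ 0 := fun h0 => by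
        have := levi_mul_self hf
        rw [h0, mul_zero] at this
        exact zero_ne_one this
      refine (mul_eq_zero.1 e.symm).resolve_left (mul_ne_zero (neg_ne_zero.2 hl) ?_)
      exact mul_ne_zero (mul_ne_zero (mul_ne_zero (he a) (he b)) (he c)) (he d)
    · have hd : a = b ∨ a = c ∨ a = d ∨ b = c ∨ b = d ∨ c = d := by tauto
      unfold wedgeOne
      rcases hd with rfl | rfl | rfl | rfl | rfl | rfl
      · rw [hT.eq_zero_left, hT.eq_zero_left]; ring
      · rw [hT.eq_zero_outer, hT.1 a b d, hT.eq_zero_left]; ring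
      · rw [hT.eq_zero_outer, hT.eq_zero_outer, hT.cycle a b c]; ring
      · rw [hT.eq_zero_left, hT.eq_zero_right]; ring
      · rw [hT.eq_zero_outer, hT.eq_zero_right, hT.2 a b c]; ring
      · rw [hT.eq_zero_right, hT.eq_zero_right]; ring
  · intro h j k
    by_cases hjk : j = k
    · subst hjk
      simp [interior, (isThreeForm_hodge T).eq_zero_right]
    · obtain ⟨a, b, c, d, hf⟩ := exists_complement_two hjk
      rw [interior_hodge_apply hT v hf, h]
      simp

/-- An antiselfdual 3-form annihilated by a non-null vector vanishes: `v ∧ T = 0` as well, and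
contracting this with `v` gives `v² T = 0`. -/
lemma eq_zero_of_interior_eq_zero {T : Tensor3} (hT : IsThreeForm T) (hd : hodge T = -T)
    {v : Fin 6 → ℝ} (hv : normSq v ≠ 0) (h : ∀ j k, interior v T j k = 0) : T = 0 := by
  have hw : wedgeOne v T = 0 := by
    rw [← interior_hodge_eq_zero_iff hT, hd]
    intro j k
    have := h j k
    simp only [interior, Pi.neg_apply, mul_neg, Finset.sum_neg_distrib] at this ⊢
    rw [this, neg_zero]
  funext j k l
  have e : normSq v * T j k l - v j * interior v T k l + v k * interior v T j l
      - v l * interior v T j k = ∑ i, eta i * v i * wedgeOne v T i j k l := by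
    simp only [normSq, interior, wedgeOne, Finset.sum_mul, Finset.mul_sum,
      ← Finset.sum_sub_distrib, ← Finset.sum_add_distrib]
    refine Finset.sum_congr rfl fun i _ => ?_
    ring
  rw [hw, h, h, h] at e
  simp only [Pi.zero_apply, mul_zero, Finset.sum_const_zero, sub_zero, add_zero] at e
  exact (mul_eq_zero.1 e).resolve_left hv

/-- Inside the totally antisymmetric `ε`, the three terms of an exterior derivative are equal. -/
lemma wedge_extDer_extDer (D D' : Fin 6 → TwoForm) :
    wedge (extDer D) (extDer D') = (1 / 4) * ∑ f, levi f *
      ((D (f 0) : Fin 6 → Fin 6 → ℝ) (f 1) (f 2) * (D' (f 3) : Fin 6 → Fin 6 → ℝ) (f 4) (f 5)) := by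
  have cyc : ∀ T : Tensor3, ∀ D : Fin 6 → TwoForm,
      ∑ f, levi f * (extDer D (f 0) (f 1) (f 2) * T (f 3) (f 4) (f 5)) = 3 * ∑ f, levi f *
        ((D (f 0) : Fin 6 → Fin 6 → ℝ) (f 1) (f 2) * T (f 3) (f 4) (f 5)) := by
    intro T D
    set σ : Equiv.Perm (Fin 6) := Equiv.swap 0 1 * Equiv.swap 1 2 with hσ
    have h1 := sum_levi_comp σ fun f =>
      (D (f 0) : Fin 6 → Fin 6 → ℝ) (f 1) (f 2) * T (f 3) (f 4) (f 5)
    have h2 := sum_levi_comp (σ * σ) fun f =>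
      (D (f 0) : Fin 6 → Fin 6 → ℝ) (f 1) (f 2) * T (f 3) (f 4) (f 5)
    have s1 : Equiv.Perm.sign σ = 1 := by rw [hσ]; decide
    rw [s1] at h1
    rw [Equiv.Perm.sign_mul, s1] at h2
    change ∑ f : Fin 6 → Fin 6, levi f *
      ((D (f 1) : Fin 6 → Fin 6 → ℝ) (f 2) (f 0) * T (f 3) (f 4) (f 5)) = _ at h1
    change ∑ f : Fin 6 → Fin 6, levi f *
      ((D (f 2) : Fin 6 → Fin 6 → ℝ) (f 0) (f 1) * T (f 3) (f 4) (f 5)) = _ at h2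
    simp only [extDer, add_mul, mul_add, Finset.sum_add_distrib, h1, h2]
    push_cast
    ring
  have hswap : ∀ S T : Tensor3, ∑ f, levi f * (S (f 0) (f 1) (f 2) * T (f 3) (f 4) (f 5)) =
      -∑ f, levi f * (T (f 0) (f 1) (f 2) * S (f 3) (f 4) (f 5)) := by
    intro S T
    have := wedge_antisymm S T
    rw [wedge_eq_sum, wedge_eq_sum] at this
    linarith
  have h3 := hswap (fun i j k => (D i : Fin 6 → Fin 6 → ℝ) j k) (extDer D')
  have h4 := hswap (fun i j k => (D' i : Fin 6 → Fin 6 → ℝ) j k)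
    (fun i j k => (D i : Fin 6 → Fin 6 → ℝ) j k)
  have h5 := cyc (fun i j k => (D i : Fin 6 → Fin 6 → ℝ) j k) D'
  rw [wedge_eq_sum, cyc]
  rw [h3, h5, h4]
  ring

/-- The Bianchi identity `d(dB) = 0`, where `D i j` stands for the second partial derivatives
`∂_i ∂_j B`. -/
lemma divPair_hodge_extDer (D : Fin 6 → Fin 6 → TwoForm) (hD : ∀ i j, D i j = D j i)
    (α : TwoForm) : divPair (fun i => hodge (extDer (D i))) α = 0 := by
  have h : divPair (fun i => hodge (extDer (D i))) α = -(3 / 2) * ∑ f, levi f *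
      ((D (f 3) (f 0) : Fin 6 → Fin 6 → ℝ) (f 1) (f 2) *
        (α : Fin 6 → Fin 6 → ℝ) (f 4) (f 5)) := by
    simp only [divPair, pair_hodge, pair_hodge_eq_wedge, wedge_extDer_extDer]
    simp only [Finset.mul_sum, ← Finset.sum_neg_distrib]
    rw [Finset.sum_comm]
    refine Finset.sum_congr rfl fun f _ => ?_
    rw [Finset.sum_eq_single (f 3)]
    · rw [Pi.single_eq_same]
      ring
    · intro i _ hi
      rw [Pi.single_eq_of_ne hi.symm]
      simp
    · simp
  -- The sum changes sign under the exchange of the indices of the two derivatives.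
  have h2 := sum_levi_comp (Equiv.swap 0 3) fun f =>
    (D (f 3) (f 0) : Fin 6 → Fin 6 → ℝ) (f 1) (f 2) * (α : Fin 6 → Fin 6 → ℝ) (f 4) (f 5)
  change ∑ f : Fin 6 → Fin 6, levi f * ((D (f 0) (f 3) : Fin 6 → Fin 6 → ℝ) (f 1) (f 2) *
    (α : Fin 6 → Fin 6 → ℝ) (f 4) (f 5)) = _ at h2
  rw [Equiv.Perm.sign_swap (by decide)] at h2
  have h3 : ∀ f : Fin 6 → Fin 6, D (f 0) (f 3) = D (f 3) (f 0) := fun f => hD _ _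
  simp only [h3] at h2
  push_cast at h2
  rw [h]
  linarith

/-! ### First variation of the Lagrangian -/

lemma fderiv_apply_eq_of_line {E : Type*} [NormedAddCommGroup E] [NormedSpace ℝ E] {f : E → ℝ}
    {x w : E} {d : ℝ} (hf : DifferentiableAt ℝ f x)
    (h : HasDerivAt (fun t : ℝ => f (x + t • w)) d 0) : fderiv ℝ f x w = d := by
  have h1 : HasDerivAt (fun t : ℝ => x + t • w) w 0 := by
    simpa using ((hasDerivAt_id (0 : ℝ)).smul_const w).const_add x
  have h2 : HasFDerivAt f (fderiv ℝ f x) (x + (0 : ℝ) • w) := by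
    rw [zero_smul, add_zero]
    exact hf.hasFDerivAt
  exact (h2.comp_hasDerivAt (0 : ℝ) h1).unique h

lemma contDiff_pair : ContDiff ℝ ∞ fun z : Tensor3 × Tensor3 => pair z.1 z.2 := by
  unfold pair raise
  fun_prop

lemma contDiff_hodge : ContDiff ℝ ∞ hodge :=
  (LinearMap.toContinuousLinearMap hodgeLin).contDiff

lemma contDiff_extDer : ContDiff ℝ ∞ extDer :=
  (LinearMap.toContinuousLinearMap extDerLin).contDiff

lemma contDiff_strengthF : ContDiff ℝ ∞ strengthF :=
  contDiff_extDer.comp (by fun_prop)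

lemma contDiff_strengthQ : ContDiff ℝ ∞ strengthQ :=
  contDiff_extDer.comp (by fun_prop)

lemma contDiff_tensorX (F : Polynomial ℝ) : ContDiff ℝ ∞ (tensorX F) := by
  have h : ContDiff ℝ ∞ (fderiv ℝ fun T => F.eval (I4 T)) :=
    (contDiff_eval_I4 F).fderiv_right (by simp)
  refine contDiff_pi.2 fun i => contDiff_pi.2 fun j => contDiff_pi.2 fun k => ?_
  exact contDiff_const.mul (h.clm_apply contDiff_const)

lemma isThreeForm_strengthF (p : Fin 6 → FieldSpace) : IsThreeForm (strengthF p) :=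
  isThreeForm_extDer _

lemma isThreeForm_strengthQ (p : Fin 6 → FieldSpace) : IsThreeForm (strengthQ p) :=
  isThreeForm_extDer _

lemma isThreeForm_strengthH (v : FieldSpace) (p : Fin 6 → FieldSpace) :
    IsThreeForm (strengthH v p) :=
  (isThreeForm_strengthF p).add ((isThreeForm_strengthQ p).smul _)

/-- The Lagrangian in terms of the pairing, where `S ∧ ⋆T = pair S T / 6`. -/
lemma lagrangian_eq (F : Polynomial ℝ) (v : FieldSpace) (p : Fin 6 → FieldSpace) :
    lagrangian (Polynomial.C (1 / 3) * F) v p =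
      (1 / 6) * pair (strengthH v p) (strengthH v p)
      + (1 / 3) * v.2.2 * pair (strengthF p) (hodge (strengthQ p))
      + (1 / 3) * F.eval (I4 (strengthH v p + hodge (strengthH v p))) := by
  rw [lagrangian, wedge_hodge _ (isThreeForm_strengthH v p), pair_hodge_eq_wedge,
    Polynomial.eval_mul, Polynomial.eval_C]
  ring

lemma contDiff_lagrangian (F : Polynomial ℝ) :
    ContDiff ℝ ∞ fun z : FieldSpace × (Fin 6 → FieldSpace) =>
      lagrangian (Polynomial.C (1 / 3) * F) z.1 z.2 := by
  have hF : ContDiff ℝ ∞ fun z : FieldSpace × (Fin 6 → FieldSpace) => strengthF z.2 :=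
    contDiff_strengthF.comp contDiff_snd
  have hQ : ContDiff ℝ ∞ fun z : FieldSpace × (Fin 6 → FieldSpace) => strengthQ z.2 :=
    contDiff_strengthQ.comp contDiff_snd
  have ha : ContDiff ℝ ∞ fun z : FieldSpace × (Fin 6 → FieldSpace) => z.1.2.2 := by
    fun_prop
  have hH : ContDiff ℝ ∞ fun z : FieldSpace × (Fin 6 → FieldSpace) => strengthH z.1 z.2 :=
    hF.add (ha.smul hQ)
  simp only [lagrangian_eq]
  refine ((contDiff_const.mul (contDiff_pair.comp (hH.prodMk hH))).add
    ((contDiff_const.mul ha).mul (contDiff_pair.comp (hF.prodMk (contDiff_hodge.comp hQ))))).add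
    (contDiff_const.mul ((contDiff_eval_I4 F).comp (hH.add (contDiff_hodge.comp hH))))

/-- The 3-form `H + X - ⋆X` dual to the momentum of the field strength `H`. -/
def momentum (F : Polynomial ℝ) (H : Tensor3) : Tensor3 :=
  H + tensorX F (H + hodge H) - hodge (tensorX F (H + hodge H))

lemma isThreeForm_momentum (F : Polynomial ℝ) {H : Tensor3} (hH : IsThreeForm H) :
    IsThreeForm (momentum F H) :=
  (hH.add (isThreeForm_tensorX _ _)).sub (isThreeForm_hodge _)

lemma contDiff_momentum (F : Polynomial ℝ) : ContDiff ℝ ∞ (momentum F) := by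
  have h := (contDiff_tensorX F).comp (contDiff_id.add contDiff_hodge)
  exact (contDiff_id.add h).sub (contDiff_hodge.comp h)

lemma hasDerivAt_line_pair (S T δ ε : Tensor3) :
    HasDerivAt (fun t : ℝ => pair (S + t • δ) (T + t • ε)) (pair δ T + pair S ε) 0 := by
  have h : (fun t : ℝ => pair (S + t • δ) (T + t • ε)) =
      fun t => pair S T + t * (pair δ T + pair S ε) + t ^ 2 * pair δ ε := by
    funext t
    simp only [pair_add_left, pair_add_right, pair_smul_left, pair_smul_right]
    ring
  rw [h]
  refine ((((hasDerivAt_id (0 : ℝ)).mul_const _).const_add _).add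
    (((hasDerivAt_id (0 : ℝ)).pow 2).mul_const _)).congr_deriv ?_
  simp

/-- The first variation of `H ∧ ⋆H + 𝓕(I₄(H + ⋆H)) / 3` with respect to `H`. -/
lemma hasDerivAt_line_kinetic (F : Polynomial ℝ) (H : Tensor3) {δ : Tensor3}
    (hδ : IsThreeForm δ) :
    HasDerivAt (fun t : ℝ => (1 / 6) * pair (H + t • δ) (H + t • δ)
      + (1 / 3) * F.eval (I4 ((H + t • δ) + hodge (H + t • δ))))
      ((1 / 3) * pair (momentum F H) δ) 0 := by
  set Y := H + hodge H with hY
  have h1 : HasDerivAt (fun t : ℝ => Y + t • (δ + hodge δ)) (δ + hodge δ) 0 := by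
    simpa using ((hasDerivAt_id (0 : ℝ)).smul_const (δ + hodge δ)).const_add Y
  have h2 : HasFDerivAt (fun T => F.eval (I4 T)) (fderiv ℝ (fun T => F.eval (I4 T)) Y)
      (Y + (0 : ℝ) • (δ + hodge δ)) := by
    rw [zero_smul, add_zero]
    exact ((contDiff_eval_I4 F).differentiable (by simp) _).hasFDerivAt
  have h3 := h2.comp_hasDerivAt (0 : ℝ) h1
  rw [← pair_formDeriv _ _ (hδ.add (isThreeForm_hodge δ))] at h3
  have h4 : (fun T => F.eval (I4 T)) ∘ (fun t : ℝ => Y + t • (δ + hodge δ)) =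
      fun t => F.eval (I4 ((H + t • δ) + hodge (H + t • δ))) := by
    funext t
    simp only [Function.comp_apply, hodge_add, hodge_smul, hY]
    congr 2
    module
  rw [h4] at h3
  refine (((hasDerivAt_line_pair H H δ δ).const_mul (1 / 6)).add (h3.const_mul (1 / 3))).congr_deriv ?_
  change 1 / 6 * (pair δ H + pair H δ) + 1 / 3 * pair (tensorX F Y) (δ + hodge δ) = _
  rw [momentum, ← hY, pair_sub_left, pair_add_left, pair_hodge, pair_add_right, pair_comm δ H]
  ring

lemma strengthF_add_smul (p δ : Fin 6 → FieldSpace) (t : ℝ) :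
    strengthF (p + t • δ) = strengthF p + t • strengthF δ := by
  rw [strengthF, strengthF, strengthF, ← extDer_smul, ← extDer_add]
  rfl

lemma strengthQ_add_smul (p δ : Fin 6 → FieldSpace) (t : ℝ) :
    strengthQ (p + t • δ) = strengthQ p + t • strengthQ δ := by
  rw [strengthQ, strengthQ, strengthQ, ← extDer_smul, ← extDer_add]
  rfl

lemma strengthF_single (i : Fin 6) (w : FieldSpace) :
    strengthF (Pi.single i w) = extDer (Pi.single i w.1) := by
  rw [strengthF]
  congr 1
  funext j
  rcases eq_or_ne j i with rfl | h
  · simp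
  · simp [h]

lemma strengthQ_single (i : Fin 6) (w : FieldSpace) :
    strengthQ (Pi.single i w) = extDer (Pi.single i w.2.1) := by
  rw [strengthQ]
  congr 1
  funext j
  rcases eq_or_ne j i with rfl | h
  · simp
  · simp [h]

/-- The variation of the Lagrangian with the derivatives of the fields. The term `2 a F ∧ Q`
adds `a ⋆Q` to the momentum of `A` and turns `E` into `E - ⋆F` in that of `R`. -/
lemma fderiv_lagrangian_snd (F : Polynomial ℝ) (v : FieldSpace) (p δ : Fin 6 → FieldSpace) :
    fderiv ℝ (lagrangian (Polynomial.C (1 / 3) * F) v) p δ =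
      (1 / 3) * (pair (momentum F (strengthH v p) + v.2.2 • hodge (strengthQ p)) (strengthF δ)
        + pair (v.2.2 • (momentum F (strengthH v p) - hodge (strengthF p))) (strengthQ δ)) := by
  have hd : DifferentiableAt ℝ (lagrangian (Polynomial.C (1 / 3) * F) v) p :=
    ((contDiff_lagrangian F).comp (contDiff_const.prodMk contDiff_id)).differentiable (by simp) p
  refine fderiv_apply_eq_of_line hd ?_
  have hH : ∀ t : ℝ, strengthH v (p + t • δ) = strengthH v p + t • strengthH v δ := by
    intro t
    simp only [strengthH, strengthF_add_smul, strengthQ_add_smul]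
    module
  simp only [lagrangian_eq, hH, strengthF_add_smul, strengthQ_add_smul, hodge_add (strengthQ p),
    hodge_smul _ (strengthQ δ)]
  refine (((hasDerivAt_line_kinetic F (strengthH v p) (isThreeForm_strengthH v δ)).add
    ((hasDerivAt_line_pair (strengthF p) (hodge (strengthQ p)) (strengthF δ)
      (hodge (strengthQ δ))).const_mul (1 / 3 * v.2.2))).congr_of_eventuallyEq
      (Filter.Eventually.of_forall fun t => ?_)).congr_deriv ?_
  · simp only [Pi.add_apply]
    ring
  · simp only [strengthH, pair_add_right, pair_smul_right, pair_add_left, pair_smul_left,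
      pair_sub_left, pair_hodge, pair_comm (strengthF δ)]
    ring

/-- The variation of the Lagrangian with the values of the fields, of which only `a` occurs. -/
lemma fderiv_lagrangian_fst (F : Polynomial ℝ) (v w : FieldSpace) (p : Fin 6 → FieldSpace) :
    fderiv ℝ (fun v => lagrangian (Polynomial.C (1 / 3) * F) v p) v w =
      (1 / 3) * (w.2.2 * pair (momentum F (strengthH v p) - hodge (strengthF p)) (strengthQ p)) := by
  have hd : DifferentiableAt ℝ (fun v => lagrangian (Polynomial.C (1 / 3) * F) v p) v :=
    ((contDiff_lagrangian F).comp (contDiff_id.prodMk contDiff_const)).differentiable (by simp) v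
  refine fderiv_apply_eq_of_line hd ?_
  have hH : ∀ t : ℝ, strengthH (v + t • w) p = strengthH v p + t • (w.2.2 • strengthQ p) := by
    intro t
    simp only [strengthH, Prod.snd_add, Prod.smul_snd, smul_eq_mul]
    module
  simp only [lagrangian_eq, hH, Prod.snd_add, Prod.smul_snd, smul_eq_mul]
  have h2 : HasDerivAt (fun t : ℝ => (1 / 3) * (v.2.2 + t * w.2.2) *
      pair (strengthF p) (hodge (strengthQ p)))
      ((1 / 3) * w.2.2 * pair (strengthF p) (hodge (strengthQ p))) 0 := by
    exact (((((hasDerivAt_id (0 : ℝ)).mul_const w.2.2).const_add v.2.2).const_mul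
      (1 / 3)).mul_const (pair (strengthF p) (hodge (strengthQ p)))).congr_deriv (by simp)
  refine (((hasDerivAt_line_kinetic F (strengthH v p)
    ((isThreeForm_strengthQ p).smul w.2.2)).add h2).congr_of_eventuallyEq
      (Filter.Eventually.of_forall fun t => ?_)).congr_deriv ?_
  · simp only [Pi.add_apply]
    ring
  · simp only [pair_smul_right, pair_sub_left, pair_hodge]
    ring

/-! ### The Euler-Lagrange equations -/

lemma contDiffAt_jet {V : Type*} [NormedAddCommGroup V] [NormedSpace ℝ V] {u : Spacetime → V}
    {x : Spacetime} (h : ContDiffAt ℝ ∞ u x) : ContDiffAt ℝ ∞ (jet u) x :=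
  contDiffAt_pi.2 fun _ => (h.fderiv_right (by simp)).clm_apply contDiffAt_const

lemma jet_linear {V W : Type*} [NormedAddCommGroup V] [NormedSpace ℝ V] [FiniteDimensional ℝ V]
    [NormedAddCommGroup W] [NormedSpace ℝ W] (f : V →ₗ[ℝ] W) {u : Spacetime → V}
    {x : Spacetime} (h : DifferentiableAt ℝ u x) (i : Fin 6) :
    jet (fun y => f (u y)) x i = f (jet u x i) := by
  have := (LinearMap.toContinuousLinearMap f).hasFDerivAt.comp x h.hasFDerivAt
  exact congrArg (fun T => T (Pi.single i 1)) this.fderiv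

lemma jet_smul {V : Type*} [NormedAddCommGroup V] [NormedSpace ℝ V] {a : Spacetime → ℝ}
    {u : Spacetime → V} {x : Spacetime} (ha : DifferentiableAt ℝ a x)
    (h : DifferentiableAt ℝ u x) (i : Fin 6) :
    jet (fun y => a y • u y) x i = jet a x i • u x + a x • jet u x i := by
  have := congrArg (fun T => T (Pi.single i 1)) (ha.hasFDerivAt.fun_smul h.hasFDerivAt).fderiv
  rw [jet, this, add_comm]
  rfl

lemma jet_add {V : Type*} [NormedAddCommGroup V] [NormedSpace ℝ V] {u w : Spacetime → V}
    {x : Spacetime} (hu : DifferentiableAt ℝ u x) (hw : DifferentiableAt ℝ w x) (i : Fin 6) :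
    jet (fun y => u y + w y) x i = jet u x i + jet w x i :=
  congrArg (fun T => T (Pi.single i 1)) (fderiv_fun_add hu hw)

lemma jet_sub {V : Type*} [NormedAddCommGroup V] [NormedSpace ℝ V] {u w : Spacetime → V}
    {x : Spacetime} (hu : DifferentiableAt ℝ u x) (hw : DifferentiableAt ℝ w x) (i : Fin 6) :
    jet (fun y => u y - w y) x i = jet u x i - jet w x i :=
  congrArg (fun T => T (Pi.single i 1)) (fderiv_fun_sub hu hw)

lemma jet_congr {V : Type*} [NormedAddCommGroup V] [NormedSpace ℝ V] {u w : Spacetime → V}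
    {x : Spacetime} (h : u =ᶠ[nhds x] w) : jet u x = jet w x := by
  funext i
  rw [jet, jet, h.fderiv_eq]

lemma jet_triple {A R : Spacetime → TwoForm} {a : Spacetime → ℝ} {x : Spacetime}
    (hA : DifferentiableAt ℝ A x) (hR : DifferentiableAt ℝ R x) (ha : DifferentiableAt ℝ a x)
    (i : Fin 6) : jet (fun y => ((A y, R y, a y) : FieldSpace)) x i =
      (jet A x i, jet R x i, jet a x i) := by
  have := hA.hasFDerivAt.prodMk (hR.hasFDerivAt.prodMk ha.hasFDerivAt)
  exact congrArg (fun T => T (Pi.single i 1)) this.fderiv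

/-- The Bianchi identity for the field strength of a smooth potential. -/
lemma divPair_hodge_jet_extDer {A : Spacetime → TwoForm} {x : Spacetime}
    (hA : ContDiffAt ℝ ∞ A x) (α : TwoForm) :
    divPair (fun i => hodge (jet (fun y => extDer (jet A y)) x i)) α = 0 := by
  have hj := contDiffAt_jet hA
  have h1 : ∀ i, jet (fun y => extDer (jet A y)) x i = extDer (jet (jet A) x i) := fun i =>
    jet_linear extDerLin (hj.differentiableAt (by simp)) i
  simp only [h1]
  refine divPair_hodge_extDer (fun i => jet (jet A) x i) (fun i j => ?_) α
  have h2 : ∀ i j, jet (jet A) x i j =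
      fderiv ℝ (fderiv ℝ A) x (Pi.single i 1) (Pi.single j 1) := by
    intro i j
    have hd : DifferentiableAt ℝ (fderiv ℝ A) x :=
      (hA.fderiv_right (m := ∞) (by simp)).differentiableAt (by simp)
    have h3 : HasFDerivAt (fun y => jet A y) (ContinuousLinearMap.pi fun j =>
        (fderiv ℝ (fderiv ℝ A) x).flip (Pi.single j 1)) x :=
      hasFDerivAt_pi.2 fun j => by
        change HasFDerivAt (fun y => fderiv ℝ A y (Pi.single j 1)) _ x
        simpa using hd.hasFDerivAt.clm_apply (hasFDerivAt_const (Pi.single j (1 : ℝ)) x)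
    rw [jet, h3.fderiv]
    rfl
  rw [h2, h2]
  refine (hA.isSymmSndFDerivAt ?_).eq _ _
  rw [minSmoothness_of_isRCLikeNormedField]
  exact WithTop.coe_le_coe.2 (le_top : (2 : ℕ∞) ≤ ⊤)

/-- The Euler-Lagrange equations at a point, where `E = H + X - ⋆X`, `F = dA`, `Q = dR` and
`H = F + a Q`: the equation of `a`, and those of `A` and `R` after use of the Bianchi identities
for `R` and `A`. -/
lemma eulerLagrange_iff (P : Polynomial ℝ) {A R : Spacetime → TwoForm} {a : Spacetime → ℝ}
    {U : Set Spacetime} (hU : IsOpen U) (hA : ∀ x ∈ U, ContDiffAt ℝ ∞ A x)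
    (hR : ∀ x ∈ U, ContDiffAt ℝ ∞ R x) (ha : ∀ x ∈ U, ContDiffAt ℝ ∞ a x)
    {E : Spacetime → Tensor3}
    (hE : E = fun y => momentum P (extDer (jet A y) + a y • extDer (jet R y)))
    {x : Spacetime} (hx : x ∈ U) :
    EulerLagrange (lagrangian (Polynomial.C (1 / 3) * P)) (fun y => (A y, R y, a y)) x ↔
      pair (E x - hodge (extDer (jet A x))) (extDer (jet R x)) = 0 ∧
      (∀ α, divPair (jet E x) α +
        divPair (fun i => jet a x i • hodge (extDer (jet R x))) α = 0) ∧
      ∀ ρ, divPair (fun i => jet a x i • (E x - hodge (extDer (jet A x)))) ρ +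
        a x * divPair (jet E x) ρ = 0 := by
  set Fs : Spacetime → Tensor3 := fun y => extDer (jet A y) with hFs
  set Qs : Spacetime → Tensor3 := fun y => extDer (jet R y) with hQs
  have cF : ContDiffAt ℝ ∞ Fs x := contDiff_extDer.contDiffAt.comp x (contDiffAt_jet (hA x hx))
  have cQ : ContDiffAt ℝ ∞ Qs x := contDiff_extDer.contDiffAt.comp x (contDiffAt_jet (hR x hx))
  have cE : ContDiffAt ℝ ∞ E x := by
    rw [hE]
    exact (contDiff_momentum P).contDiffAt.comp x (cF.add ((ha x hx).smul cQ))
  have da := (ha x hx).differentiableAt (by simp)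
  have dF := cF.differentiableAt (by simp)
  have dQ := cQ.differentiableAt (by simp)
  have dE := cE.differentiableAt (by simp)
  have dsF : DifferentiableAt ℝ (fun y => hodge (Fs y)) x :=
    (contDiff_hodge.contDiffAt.comp x cF).differentiableAt (by simp)
  have dsQ : DifferentiableAt ℝ (fun y => hodge (Qs y)) x :=
    (contDiff_hodge.contDiffAt.comp x cQ).differentiableAt (by simp)
  have hjets : ∀ y ∈ U, strengthF (jet (fun y => ((A y, R y, a y) : FieldSpace)) y) = Fs y ∧
      strengthQ (jet (fun y => ((A y, R y, a y) : FieldSpace)) y) = Qs y := by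
    intro y hy
    have h := jet_triple ((hA y hy).differentiableAt (by simp))
      ((hR y hy).differentiableAt (by simp)) ((ha y hy).differentiableAt (by simp))
    simp only [strengthF, strengthQ, h, hFs, hQs, and_self]
  -- The momenta of `A` and `R`, up to the common factor `1 / 3`.
  set K₁ : Spacetime → Tensor3 := fun y => E y + a y • hodge (Qs y) with hK₁
  set K₂ : Spacetime → Tensor3 := fun y => a y • (E y - hodge (Fs y)) with hK₂
  have dK₁ : DifferentiableAt ℝ K₁ x := dE.add (da.fun_smul dsQ)
  have dK₂ : DifferentiableAt ℝ K₂ x := da.fun_smul (dE.fun_sub dsF)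
  have hmom : ∀ i (w : FieldSpace), jet (fun y => fderiv ℝ
      (lagrangian (Polynomial.C (1 / 3) * P) (A y, R y, a y))
        (jet (fun y => ((A y, R y, a y) : FieldSpace)) y) (Pi.single i w)) x i =
      (1 / 3) * (pair (jet K₁ x i) (extDer (Pi.single i w.1))
        + pair (jet K₂ x i) (extDer (Pi.single i w.2.1))) := by
    intro i w
    have h1 : (fun y => fderiv ℝ (lagrangian (Polynomial.C (1 / 3) * P) (A y, R y, a y))
        (jet (fun y => ((A y, R y, a y) : FieldSpace)) y) (Pi.single i w)) =ᶠ[nhds x]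
        fun y => ((1 / 3 : ℝ) • pairLin.flip (extDer (Pi.single i w.1))) (K₁ y)
          + ((1 / 3 : ℝ) • pairLin.flip (extDer (Pi.single i w.2.1))) (K₂ y) := by
      filter_upwards [hU.mem_nhds hx] with y hy
      rw [fderiv_lagrangian_snd, strengthF_single, strengthQ_single, strengthH, (hjets y hy).1,
        (hjets y hy).2, mul_add, hK₁, hK₂, hE]
      rfl
    have d1 : DifferentiableAt ℝ (fun y =>
        ((1 / 3 : ℝ) • pairLin.flip (extDer (Pi.single i w.1))) (K₁ y)) x :=
      (LinearMap.toContinuousLinearMap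
        ((1 / 3 : ℝ) • pairLin.flip (extDer (Pi.single i w.1)))).differentiableAt.comp x dK₁
    have d2 : DifferentiableAt ℝ (fun y =>
        ((1 / 3 : ℝ) • pairLin.flip (extDer (Pi.single i w.2.1))) (K₂ y)) x :=
      (LinearMap.toContinuousLinearMap
        ((1 / 3 : ℝ) • pairLin.flip (extDer (Pi.single i w.2.1)))).differentiableAt.comp x dK₂
    rw [jet_congr h1, jet_add d1 d2, jet_linear _ dK₁, jet_linear _ dK₂, mul_add]
    rfl
  have hdK₁ : ∀ α, divPair (jet K₁ x) α = divPair (jet E x) α +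
      divPair (fun i => jet a x i • hodge (Qs x)) α := by
    intro α
    have h : jet K₁ x = jet E x + ((fun i => jet a x i • hodge (Qs x))
        + a x • fun i => hodge (jet Qs x i)) := by
      funext i
      rw [hK₁, jet_add dE (da.fun_smul dsQ), jet_smul da dsQ]
      rw [show jet (fun y => hodge (Qs y)) x i = hodge (jet Qs x i) from jet_linear hodgeLin dQ i]
      rfl
    rw [h, divPair_add, divPair_add, divPair_smul, divPair_hodge_jet_extDer (hR x hx), mul_zero,
      add_zero]
  have hdK₂ : ∀ ρ, divPair (jet K₂ x) ρ =
      divPair (fun i => jet a x i • (E x - hodge (Fs x))) ρ + a x * divPair (jet E x) ρ := by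
    intro ρ
    have h : jet K₂ x = (fun i => jet a x i • (E x - hodge (Fs x)))
        + a x • (jet E x - fun i => hodge (jet Fs x i)) := by
      funext i
      rw [hK₂, jet_smul da (dE.fun_sub dsF), jet_sub dE dsF]
      rw [show jet (fun y => hodge (Fs y)) x i = hodge (jet Fs x i) from jet_linear hodgeLin dF i]
      rfl
    rw [h, divPair_add, divPair_smul, divPair_sub, divPair_hodge_jet_extDer (hA x hx), sub_zero]
  have hsum : ∀ w : FieldSpace, ∑ i, jet (fun y => fderiv ℝ
      (lagrangian (Polynomial.C (1 / 3) * P) (A y, R y, a y))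
        (jet (fun y => ((A y, R y, a y) : FieldSpace)) y) (Pi.single i w)) x i =
      (1 / 3) * (divPair (jet K₁ x) w.1 + divPair (jet K₂ x) w.2.1) := by
    intro w
    simp only [hmom, divPair, ← Finset.mul_sum, Finset.sum_add_distrib]
  have hval : ∀ w : FieldSpace, fderiv ℝ (fun v => lagrangian (Polynomial.C (1 / 3) * P) v
      (jet (fun y => ((A y, R y, a y) : FieldSpace)) x)) (A x, R x, a x) w =
      (1 / 3) * (w.2.2 * pair (E x - hodge (Fs x)) (Qs x)) := by
    intro w
    rw [fderiv_lagrangian_fst, strengthH, (hjets x hx).1, (hjets x hx).2, hE]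
  have hEL : EulerLagrange (lagrangian (Polynomial.C (1 / 3) * P)) (fun y => (A y, R y, a y)) x ↔
      ∀ w : FieldSpace, (1 / 3) * (w.2.2 * pair (E x - hodge (Fs x)) (Qs x)) =
        (1 / 3) * (divPair (jet K₁ x) w.1 + divPair (jet K₂ x) w.2.1) := by
    refine forall_congr' fun w => ?_
    rw [← hval w, ← hsum w]
  have hzero : ∀ D : Fin 6 → Tensor3, divPair D 0 = 0 := by
    intro D
    refine Finset.sum_eq_zero fun i _ => ?_
    rw [Pi.single_zero]
    exact (congrArg (pair (D i)) extDerLin.map_zero).trans (map_zero (pairLin (D i)))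
  rw [hEL]
  constructor
  · intro h
    refine ⟨?_, fun α => ?_, fun ρ => ?_⟩
    · have := h (0, 0, 1)
      simp only [hzero] at this
      linarith
    · have := h (α, 0, 0)
      simp only [hzero] at this
      rw [← hdK₁]
      linarith
    · have := h (0, ρ, 0)
      simp only [hzero] at this
      rw [← hdK₂]
      linarith
  · rintro ⟨h1, h2, h3⟩ w
    rw [h1, hdK₁, h2, hdK₂, h3, mul_zero, add_zero]

/-- The equation `⋆H - H + ⋆X - X = 0` says that the momentum of `H` is its Hodge dual. -/
lemma momentum_eq_hodge_iff (F : Polynomial ℝ) (H : Tensor3) : momentum F H = hodge H ↔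
    hodge H - H + hodge (tensorX F (H + hodge H)) - tensorX F (H + hodge H) = 0 := by
  rw [← sub_eq_zero, ← neg_eq_zero, momentum]
  constructor <;> intro h <;> rw [← h] <;> abel

/-- The 3-form `E - ⋆H` is antiselfdual. -/
lemma hodge_momentum_sub (F : Polynomial ℝ) {H : Tensor3} (hH : IsThreeForm H) :
    hodge (momentum F H - hodge H) = -(momentum F H - hodge H) := by
  simp only [momentum, hodge_sub, hodge_add, hodge_hodge hH,
    hodge_hodge (isThreeForm_tensorX F (H + hodge H))]
  abel

/-- The Euler-Lagrange equations of the Lagrangian on an open set. The equations of `A` and `R`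
combine to the vanishing of the contraction of `da` with the antiselfdual form `E - ⋆H`. -/
lemma forall_eulerLagrange_iff (P : Polynomial ℝ) {A R : Spacetime → TwoForm} {a : Spacetime → ℝ}
    {U : Set Spacetime} (hU : IsOpen U) (hA : ContDiffOn ℝ ∞ A U)
    (hR : ContDiffOn ℝ ∞ R U) (ha : ContDiffOn ℝ ∞ a U) (hn : ∀ x ∈ U, normSq (jet a x) ≠ 0) :
    (∀ x ∈ U, EulerLagrange (lagrangian (Polynomial.C (1 / 3) * P))
      (fun y => (A y, R y, a y)) x) ↔
    ∀ x ∈ U, wedgeOne (jet a x) (extDer (jet R x)) = 0 ∧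
      momentum P (extDer (jet A x) + a x • extDer (jet R x)) =
        hodge (extDer (jet A x) + a x • extDer (jet R x)) := by
  have hA' : ∀ x ∈ U, ContDiffAt ℝ ∞ A x := fun x hx => hA.contDiffAt (hU.mem_nhds hx)
  have hR' : ∀ x ∈ U, ContDiffAt ℝ ∞ R x := fun x hx => hR.contDiffAt (hU.mem_nhds hx)
  have ha' : ∀ x ∈ U, ContDiffAt ℝ ∞ a x := fun x hx => ha.contDiffAt (hU.mem_nhds hx)
  set Fs : Spacetime → Tensor3 := fun y => extDer (jet A y) with hFs
  set Qs : Spacetime → Tensor3 := fun y => extDer (jet R y) with hQs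
  set H : Spacetime → Tensor3 := fun y => Fs y + a y • Qs y with hH
  set E : Spacetime → Tensor3 := fun y => momentum P (H y) with hE
  have tQ : ∀ y, IsThreeForm (Qs y) := fun y => isThreeForm_extDer _
  have tH : ∀ y, IsThreeForm (H y) := fun y => (isThreeForm_extDer _).add ((tQ y).smul _)
  have hEL := fun x (hx : x ∈ U) => eulerLagrange_iff P hU hA' hR' ha' (E := E) rfl hx
  have hsH : ∀ y, hodge (H y) = hodge (Fs y) + a y • hodge (Qs y) := fun y => by
    rw [hH]
    simp only
    rw [hodge_add, hodge_smul]
  -- Where `E = ⋆H`, the divergence of `E` is fixed by the Bianchi identities for `A` and `R`.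
  have hdiv : (∀ x ∈ U, E x = hodge (H x)) → ∀ x ∈ U, ∀ α,
      divPair (jet E x) α = divPair (fun i => jet a x i • hodge (Qs x)) α := by
    intro h x hx α
    have dF : DifferentiableAt ℝ Fs x :=
      (contDiff_extDer.contDiffAt.comp x (contDiffAt_jet (hA' x hx))).differentiableAt (by simp)
    have dQ : DifferentiableAt ℝ Qs x :=
      (contDiff_extDer.contDiffAt.comp x (contDiffAt_jet (hR' x hx))).differentiableAt (by simp)
    have da := (ha' x hx).differentiableAt (by simp)
    have h1 : jet E x = jet (fun y => hodge (H y)) x :=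
      jet_congr (Filter.eventually_of_mem (hU.mem_nhds hx) h)
    have h2 : jet E x = (fun i => hodge (jet Fs x i)) + ((fun i => jet a x i • hodge (Qs x))
        + a x • fun i => hodge (jet Qs x i)) := by
      rw [h1]
      funext i
      rw [show jet (fun y => hodge (H y)) x i = hodge (jet H x i) from
        jet_linear hodgeLin (dF.add (da.fun_smul dQ)) i, hH, jet_add dF (da.fun_smul dQ),
        jet_smul da dQ, hodge_add, hodge_add, hodge_smul, hodge_smul]
      rfl
    rw [h2, divPair_add, divPair_add, divPair_smul, divPair_hodge_jet_extDer (hR' x hx),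
      divPair_hodge_jet_extDer (hA' x hx)]
    ring
  have hcontr : ∀ x, (∀ α, divPair (fun i => jet a x i • hodge (Qs x)) α = 0) ↔
      wedgeOne (jet a x) (Qs x) = 0 := fun x => by
    rw [forall_divPair_smul_eq_zero_iff (isThreeForm_hodge _), interior_hodge_eq_zero_iff (tQ x)]
  constructor
  · intro h
    have hsd : ∀ x ∈ U, E x = hodge (H x) := by
      intro x hx
      obtain ⟨-, h2, h3⟩ := (hEL x hx).1 (h x hx)
      have h4 : ∀ α, divPair (fun i => jet a x i • (E x - hodge (H x))) α = 0 := by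
        intro α
        have e : (fun i => jet a x i • (E x - hodge (H x))) =
            (fun i => jet a x i • (E x - hodge (Fs x)))
              - a x • fun i => jet a x i • hodge (Qs x) := by
          funext i
          simp only [hsH, Pi.sub_apply, Pi.smul_apply]
          module
        rw [e, divPair_sub, divPair_smul]
        linear_combination h3 α - a x * h2 α
      have t : IsThreeForm (E x - hodge (H x)) :=
        (isThreeForm_momentum P (tH x)).sub (isThreeForm_hodge _)
      exact sub_eq_zero.1 (eq_zero_of_interior_eq_zero t (hodge_momentum_sub P (tH x)) (hn x hx)
        ((forall_divPair_smul_eq_zero_iff t _).1 h4))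
    intro x hx
    refine ⟨(hcontr x).1 fun α => ?_, hsd x hx⟩
    obtain ⟨-, h2, -⟩ := (hEL x hx).1 (h x hx)
    have := h2 α
    rw [hdiv hsd x hx] at this
    linarith
  · intro h x hx
    have hsd : ∀ x ∈ U, E x = hodge (H x) := fun x hx => (h x hx).2
    have h0 := (hcontr x).2 (h x hx).1
    have e : E x - hodge (Fs x) = a x • hodge (Qs x) := by
      rw [hsd x hx, hsH, add_sub_cancel_left]
    refine (hEL x hx).2 ⟨?_, fun α => ?_, fun ρ => ?_⟩
    · change pair (E x - hodge (Fs x)) (Qs x) = 0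
      rw [e, pair_smul_left, pair_hodge_self, mul_zero]
    · rw [hdiv hsd x hx, h0, add_zero]
    · change divPair (fun i => jet a x i • (E x - hodge (Fs x))) ρ + _ = 0
      have e2 : (fun i => jet a x i • (E x - hodge (Fs x))) =
          a x • fun i => jet a x i • hodge (Qs x) := by
        funext i
        rw [e, Pi.smul_apply, smul_comm]
      rw [e2, divPair_smul, hdiv hsd x hx, h0]
      ring

end Chiral6d

end

theorem mainTheorem4 (g : Tensor3 → Tensor3) (hg : IsCovariantPolynomial g) :
    ∃ F : Polynomial ℝ,
      -- the selfduality equation is the equation `⋆H - H + ⋆X - X = 0`, `X = ∂𝓕(I₄)/∂Y`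
      (∀ H : Tensor3, IsThreeForm H →
        (SelfdualityEq g H ↔
          hodge H - H + hodge (tensorX F (H + hodge H)) - tensorX F (H + hodge H) = 0)) ∧
      -- the equations of motion of the Lagrangian theory amount to `da ∧ dR = 0` and the
      -- selfduality equation for `H = dA + a dR`
      (∀ (U : Set Spacetime) (A R : Spacetime → TwoForm) (a : Spacetime → ℝ), IsOpen U →
        ContDiffOn ℝ ∞ A U → ContDiffOn ℝ ∞ R U → ContDiffOn ℝ ∞ a U →
        (∀ x ∈ U, normSq (jet a x) ≠ 0) →
        ((∀ x ∈ U, EulerLagrange (lagrangian (Polynomial.C (1 / 3) * F))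
            (fun y => (A y, R y, a y)) x) ↔
          ∀ x ∈ U, wedgeOne (jet a x) (extDer (jet R x)) = 0 ∧
            SelfdualityEq g (extDer (jet A x) + a x • extDer (jet R x)))) ∧
      -- with the auxiliary form gauged to `R = 0` they are the selfduality equation for `F = dA`
      (∀ (U : Set Spacetime) (A : Spacetime → TwoForm) (a : Spacetime → ℝ), IsOpen U →
        ContDiffOn ℝ ∞ A U → ContDiffOn ℝ ∞ a U →
        (∀ x ∈ U, normSq (jet a x) ≠ 0) →
        ((∀ x ∈ U, EulerLagrange (lagrangian (Polynomial.C (1 / 3) * F))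
            (fun y => (A y, 0, a y)) x) ↔
          ∀ x ∈ U, SelfdualityEq g (extDer (jet A x)))) := by
  obtain ⟨F, hF⟩ := hg.exists_tensorX
  have h1 : ∀ H : Tensor3, IsThreeForm H → (SelfdualityEq g H ↔
      hodge H - H + hodge (tensorX F (H + hodge H)) - tensorX F (H + hodge H) = 0) := by
    intro H hH
    rw [SelfdualityEq, hF _ (isSelfdual_add_hodge hH), ← sub_eq_zero, ← neg_eq_zero]
    constructor <;> intro h <;> rw [← h] <;> abel
  have h2 : ∀ (A R : Fin 6 → TwoForm) (a : ℝ), SelfdualityEq g (extDer A + a • extDer R) ↔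
      momentum F (extDer A + a • extDer R) = hodge (extDer A + a • extDer R) := fun A R a => by
    rw [momentum_eq_hodge_iff,
      h1 _ ((isThreeForm_extDer A).add ((isThreeForm_extDer R).smul a))]
  refine ⟨F, h1, fun U A R a hU hA hR ha hn => ?_, fun U A a hU hA ha hn => ?_⟩
  · rw [forall_eulerLagrange_iff F hU hA hR ha hn]
    simp only [h2]
  · rw [forall_eulerLagrange_iff F hU hA contDiffOn_const ha hn]
    have hz : ∀ x, extDer (jet (fun _ : Spacetime => (0 : TwoForm)) x) = 0 := by
      intro x
      have : jet (fun _ : Spacetime => (0 : TwoForm)) x = 0 := by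
        funext i
        simp [jet]
      rw [this]
      exact extDerLin.map_zero
    refine forall₂_congr fun x _ => ?_
    rw [← h2, hz, smul_zero, add_zero]
    refine and_iff_right ?_
    funext i j k l
    simp [wedgeOne]
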